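/- **Setting.** A *countable signature* $\Omega$ consists of countably many function symbols and real-valued relation symbols of finite arities $m\ge 0$ (constants are the $0$-ary function symbols); for each symbol $S$, each integer $N\ge 1$ and each rational $\varepsilon>0$, a rational $\delta(S,N,\varepsilon)>0$; and for each symbol $S$ and each integer $N\ge 0$ an integer $K(S,N)\ge 0$. A *normed space structure* (for $\Omega$) is a real normed space $E$ (not necessarily complete) with a function $f:E^m\to E$ for each $m$-ary function symbol and a function $R:E^m\to\mathbb R$ for each $m$-ary relation symbol, such that, for $S$ any of these functions: if $\|x_k\|,\|y_k\|<N$ and $\|x_k-y_k\|<\delta(S,N,\varepsilon)$ for $1\le k\le m$, then $\|S(\vec x)-S(\vec y)\|\le\varepsilon$ (with $|\cdot|$ instead of $\|\cdot\|$ for relations); and if $\|x_k\|\le N$ for $1\le k\le m$, then $\|S(\vec x)\|\le K(S,N)$ (resp. $|S(\vec x)|\le K(S,N)$). *Terms* are built from countably many variables with $0$, $+$, multiplication by rational scalars and the function symbols. *Positive bounded formulas* are built from the atomic formulas $\|t\|\le r$, $\|t\|\ge r$, $R(\vec t)\le r$, $R(\vec t)\ge r$ ($r\in\mathbb Q$)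 by binary $\wedge$ and $\vee$, countable conjunctions $\bigwedge_{i=1}^\infty\phi_i$, and the bounded quantifiers $\exists y(\|y\|\le r\wedge\phi)$ and $\forall y(\|y\|\le r\Rightarrow\phi)$, $r\in\mathbb Q$. The logic $L_{PB}$ consists of those in which every existential bound satisfies $r\ge 0$ and every universal bound satisfies $r>0$. The logic $L_A$ is the closure of $L_{PB}$ under finite (nonempty) conjunctions $\bigwedge_{i=1}^m\phi_i$, countable conjunctions $\bigwedge_{i=1}^\infty\phi_i$, negation, and $\exists\vec y(\bigwedge_{i=1}^\infty\|y_i\|\le r_i\wedge\phi)$, where $y_1,y_2,\dots$ are distinct variables and $r_1,r_2,\dots$ are nonnegative rationals. Satisfaction $E\models\phi(\vec a)$ is the natural one; sentences are formulas without free variables. For a positive bounded formula $\phi$ and an integer $n\ge1$, the formulas $\phi_n$ and $neg(\phi,n)$ are defined as follows ($\|\cdot\|$ stands also for $R(\cdot)$): - $(\|t\|\le r)_n$ is $\|t\|\le r+\frac1n$ and $(\|t\|\ge r)_n$ is $\|t\|\ge r-\frac1n$; $neg(\|t\|\le r,n)$ is $\|t\|\ge r+\frac1n$ and $neg(\|t\|\ge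 r,n)$ is $\|t\|\le r-\frac1n$. - $(\phi\wedge\psi)_n$ is $\phi_n\wedge\psi_n$, $(\phi\vee\psi)_n$ is $\phi_n\vee\psi_n$, $(\bigwedge_{i=1}^\infty\phi_i)_n$ is $\bigwedge_{i=1}^n(\phi_i)_n$; $neg(\phi\wedge\psi,n)$ is $neg(\phi,n)\vee neg(\psi,n)$, $neg(\phi\vee\psi,n)$ is $neg(\phi,n)\wedge neg(\psi,n)$, $neg(\bigwedge_{i=1}^\infty\phi_i,n)$ is $\bigvee_{i=1}^n neg(\phi_i,n)$. - $(\exists y(\|y\|\le r\wedge\phi))_n$ is $\exists y(\|y\|\le r+\frac1n\wedge\phi_n)$ and $(\forall y(\|y\|\le r\Rightarrow\phi))_n$ is $\forall y(\|y\|\le r-\frac1n\Rightarrow\phi_n)$; $neg(\exists y(\|y\|\le r\wedge\phi),n)$ is $\forall y(\|y\|\le r+\frac1n\Rightarrow neg(\phi,n))$ and $neg(\forall y(\|y\|\le r\Rightarrow\phi),n)$ is $\exists y(\|y\|\le r-\frac1n\wedge neg(\phi,n))$. For $\phi\in L_A$, the set of branches $I(\phi)$ and the positive bounded formulas $[\phi]_h$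 ($h\in I(\phi)$) are defined by recursion: - for $\phi\in L_{PB}$, $I(\phi)=\{\emptyset\}$ and $[\phi]_\emptyset$ is $\phi$; - $I(\bigwedge_i\phi_i)=\prod_i I(\phi_i)$ and $[\bigwedge_i\phi_i]_h$ is $\bigwedge_i[\phi_i]_{h(i)}$, for finite and for countable conjunctions; - $I(\neg\phi)$ is the set of sequences $f=(f_1,f_2)$ of pairs $(f_1(s),f_2(s))$, $s\ge1$, of a branch in $I(\phi)$ and an integer $\ge1$, such that for every $h\in I(\phi)$ there is an $s$ for which $([\phi]_h)_{f_2(s)}$ and $([\phi]_{f_1(s)})_{f_2(s)}$ are the same formula; $[\neg\phi]_f$ is $\bigwedge_{s=1}^\infty neg([\phi]_{f_1(s)},f_2(s))$; - $I(\exists\vec y(\bigwedge_i\|y_i\|\le r_i\wedge\phi))=I(\phi)$, and $[\exists\vec y(\bigwedge_i\|y_i\|\le r_i\wedge\phi)]_h$ is $$\bigwedge_{n=1}^\infty\exists y_1\Big(\|y_1\|\le r_1\wedge\cdots\exists y_{k_n}\big(\|y_{k_n}\|\le r_{k_n}\wedge([\phi]_h)_n\big)\cdots\Big),$$ where $k_n$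 is the largest index $i$ such that $y_i$ is free in $([\phi]_h)_n$ (and $k_n=0$, with no quantifier, if there is none). A structure $E$ *approximately satisfies* $\phi(\vec a)$, written $E\models_{AP}\phi(\vec a)$, if there is an $h\in I(\phi)$ with $E\models([\phi]_h)_n(\vec a)$ for all $n\ge1$. A set $\Theta$ of sentences of $L_A$ is *approximately finitely consistent* if one can choose $h(\sigma)\in I(\sigma)$ for each $\sigma\in\Theta$ such that for every finite $F\subseteq\Theta$ and every $n\ge1$ there is a normed space structure $E_n$ with $E_n\models([\sigma]_{h(\sigma)})_n$ for all $\sigma\in F$. **Theorem (Model Existence).** Let $\Omega$ be a countable signature and let $\Theta$ be an approximately finitely consistent set of sentences of $L_A$. Then there is a normed space structure $E$ for $\Omega$ such that $E\models_{AP}\sigma$ and $E\models\sigma$ for every $\sigma\in\Theta$. -/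

import Mathlib

universe u w

namespace ApproxTruth

/-- A signature for normed space structures: function and real-valued relation symbols of each
arity, moduli of uniform continuity on the bounded sets `{‖x‖ < N}`, and bounds on the sets
`{‖x‖ ≤ N}`.  Constants are the `0`-ary function symbols. -/
structure Signature : Type (u + 1) where
  Func : ℕ → Type u
  Rel : ℕ → Type u
  funMod : ∀ {m : ℕ}, Func m → ℕ+ → {ε : ℚ // 0 < ε} → {δ : ℚ // 0 < δ}
  relMod : ∀ {m : ℕ}, Rel m → ℕ+ → {ε : ℚ // 0 < ε} → {δ : ℚ // 0 < δ}
  funBound : ∀ {m : ℕ}, Func m → ℕ → ℕ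
  relBound : ∀ {m : ℕ}, Rel m → ℕ → ℕ

/-- A signature is countable if it has countably many symbols. -/
def Signature.IsCountable (Ω : Signature.{u}) : Prop :=
  (∀ m, Countable (Ω.Func m)) ∧ (∀ m, Countable (Ω.Rel m))

/-- An `Ω`-structure: a real normed space (not assumed complete) with functions and real-valued
relations obeying the moduli of uniform continuity and the bounds that `Ω` prescribes. -/
structure NormedStructure (Ω : Signature.{u}) : Type (max u (w + 1)) where
  carrier : Type w
  [group : NormedAddCommGroup carrier]
  [space : NormedSpace ℝ carrier]
  funMap : ∀ {m : ℕ}, Ω.Func m → (Fin m → carrier) → carrier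
  relMap : ∀ {m : ℕ}, Ω.Rel m → (Fin m → carrier) → ℝ
  fun_unif : ∀ {m : ℕ} (f : Ω.Func m) (N : ℕ+) (ε : {ε : ℚ // 0 < ε}) (x y : Fin m → carrier),
    (∀ k, ‖x k‖ < (N : ℕ) ∧ ‖y k‖ < (N : ℕ) ∧ ‖x k - y k‖ < ((Ω.funMod f N ε : ℚ) : ℝ)) →
      ‖funMap f x - funMap f y‖ ≤ ((ε : ℚ) : ℝ)
  rel_unif : ∀ {m : ℕ} (R : Ω.Rel m) (N : ℕ+) (ε : {ε : ℚ // 0 < ε}) (x y : Fin m → carrier),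
    (∀ k, ‖x k‖ < (N : ℕ) ∧ ‖y k‖ < (N : ℕ) ∧ ‖x k - y k‖ < ((Ω.relMod R N ε : ℚ) : ℝ)) →
      |relMap R x - relMap R y| ≤ ((ε : ℚ) : ℝ)
  fun_bound : ∀ {m : ℕ} (f : Ω.Func m) (N : ℕ) (x : Fin m → carrier),
    (∀ k, ‖x k‖ ≤ (N : ℝ)) → ‖funMap f x‖ ≤ (Ω.funBound f N : ℝ)
  rel_bound : ∀ {m : ℕ} (R : Ω.Rel m) (N : ℕ) (x : Fin m → carrier),
    (∀ k, ‖x k‖ ≤ (N : ℝ)) → |relMap R x| ≤ (Ω.relBound R N : ℝ)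

attribute [instance] NormedStructure.group NormedStructure.space

/-- Terms of the first-order language of `Ω`; the variables are the natural numbers. -/
inductive Term (Ω : Signature.{u}) : Type u where
  | var (x : ℕ) : Term Ω
  | zero : Term Ω
  | add (s t : Term Ω) : Term Ω
  | smul (q : ℚ) (t : Term Ω) : Term Ω
  | func {m : ℕ} (f : Ω.Func m) (ts : Fin m → Term Ω) : Term Ω

namespace Term

variable {Ω : Signature.{u}}

def vars : Term Ω → Set ℕ
  | var x => {x}
  | zero => ∅
  | add s t => s.vars ∪ t.vars
  | smul _ t => t.vars
  | func _ ts => ⋃ k, (ts k).vars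

def eval (E : NormedStructure.{u, w} Ω) (a : ℕ → E.carrier) : Term Ω → E.carrier
  | var x => a x
  | zero => 0
  | add s t => s.eval E a + t.eval E a
  | smul q t => (q : ℝ) • t.eval E a
  | func f ts => E.funMap f (fun k => (ts k).eval E a)

theorem vars_finite (t : Term Ω) : t.vars.Finite := by
  induction t with
  | var x => exact Set.finite_singleton x
  | zero => exact Set.finite_empty
  | add s t hs ht => exact hs.union ht
  | smul q t ht => exact ht
  | func f ts ih => exact Set.finite_iUnion ih

end Term

/-- Positive bounded formulas.  The bounds of the quantifiers are arbitrary rationals here, because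
approximating a formula may turn a bound `r` into a nonpositive `r - 1/n`; the formulas of `L_PB`
are the ones that satisfy `PBFormula.WellFormed`. -/
inductive PBFormula (Ω : Signature.{u}) : Type u where
  /-- `‖t‖ ≤ r` -/
  | normLe (t : Term Ω) (r : ℚ) : PBFormula Ω
  /-- `‖t‖ ≥ r` -/
  | normGe (t : Term Ω) (r : ℚ) : PBFormula Ω
  /-- `R(t₁, …, tₘ) ≤ r` -/
  | relLe {m : ℕ} (R : Ω.Rel m) (ts : Fin m → Term Ω) (r : ℚ) : PBFormula Ω
  /-- `R(t₁, …, tₘ) ≥ r` -/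
  | relGe {m : ℕ} (R : Ω.Rel m) (ts : Fin m → Term Ω) (r : ℚ) : PBFormula Ω
  | and (φ ψ : PBFormula Ω) : PBFormula Ω
  | or (φ ψ : PBFormula Ω) : PBFormula Ω
  /-- the countable conjunction of `φ 0, φ 1, φ 2, …` -/
  | inf (φ : ℕ → PBFormula Ω) : PBFormula Ω
  /-- `∃ x (‖x‖ ≤ r ∧ φ)` -/
  | ex (x : ℕ) (r : ℚ) (φ : PBFormula Ω) : PBFormula Ω
  /-- `∀ x (‖x‖ ≤ r ⇒ φ)` -/
  | all (x : ℕ) (r : ℚ) (φ : PBFormula Ω) : PBFormula Ω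

namespace PBFormula

variable {Ω : Signature.{u}}

/-- Membership in `L_PB`: existential bounds are nonnegative, universal bounds are positive. -/
def WellFormed : PBFormula Ω → Prop
  | normLe _ _ => True
  | normGe _ _ => True
  | relLe _ _ _ => True
  | relGe _ _ _ => True
  | and φ ψ => φ.WellFormed ∧ ψ.WellFormed
  | or φ ψ => φ.WellFormed ∧ ψ.WellFormed
  | inf φ => ∀ i, (φ i).WellFormed
  | ex _ r φ => 0 ≤ r ∧ φ.WellFormed
  | all _ r φ => 0 < r ∧ φ.WellFormed

def freeVars : PBFormula Ω → Set ℕ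
  | normLe t _ => t.vars
  | normGe t _ => t.vars
  | relLe _ ts _ => ⋃ k, (ts k).vars
  | relGe _ ts _ => ⋃ k, (ts k).vars
  | and φ ψ => φ.freeVars ∪ ψ.freeVars
  | or φ ψ => φ.freeVars ∪ ψ.freeVars
  | inf φ => ⋃ i, (φ i).freeVars
  | ex x _ φ => φ.freeVars \ {x}
  | all x _ φ => φ.freeVars \ {x}

/-- Satisfaction `E ⊨ φ(a)`. -/
def Sat (E : NormedStructure.{u, w} Ω) : PBFormula Ω → (ℕ → E.carrier) → Prop
  | normLe t r, a => ‖t.eval E a‖ ≤ (r : ℝ)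
  | normGe t r, a => (r : ℝ) ≤ ‖t.eval E a‖
  | relLe R ts r, a => E.relMap R (fun k => (ts k).eval E a) ≤ (r : ℝ)
  | relGe R ts r, a => (r : ℝ) ≤ E.relMap R (fun k => (ts k).eval E a)
  | and φ ψ, a => φ.Sat E a ∧ ψ.Sat E a
  | or φ ψ, a => φ.Sat E a ∨ ψ.Sat E a
  | inf φ, a => ∀ i, (φ i).Sat E a
  | ex x r φ, a => ∃ y : E.carrier, ‖y‖ ≤ (r : ℝ) ∧ φ.Sat E (Function.update a x y)
  | all x r φ, a => ∀ y : E.carrier, ‖y‖ ≤ (r : ℝ) → φ.Sat E (Function.update a x y)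

/-- The finite conjunction of `φ 0, …, φ n`. -/
def bigAnd (φ : ℕ → PBFormula Ω) : ℕ → PBFormula Ω
  | 0 => φ 0
  | n + 1 => and (bigAnd φ n) (φ (n + 1))

/-- The finite disjunction of `φ 0, …, φ n`. -/
def bigOr (φ : ℕ → PBFormula Ω) : ℕ → PBFormula Ω
  | 0 => φ 0
  | n + 1 => or (bigOr φ n) (φ (n + 1))

/-- The approximate formulas.  Levels are counted from `0`: `φ.approx n` is the formula usually
written `(φ)_{n+1}`, with tolerance `1/(n+1)` and the first `n + 1` conjuncts of each countable
conjunction. -/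
def approx (n : ℕ) : PBFormula Ω → PBFormula Ω
  | normLe t r => normLe t (r + 1 / ((n : ℚ) + 1))
  | normGe t r => normGe t (r - 1 / ((n : ℚ) + 1))
  | relLe R ts r => relLe R ts (r + 1 / ((n : ℚ) + 1))
  | relGe R ts r => relGe R ts (r - 1 / ((n : ℚ) + 1))
  | and φ ψ => and (φ.approx n) (ψ.approx n)
  | or φ ψ => or (φ.approx n) (ψ.approx n)
  | inf φ => bigAnd (fun i => (φ i).approx n) n
  | ex x r φ => ex x (r + 1 / ((n : ℚ) + 1)) (φ.approx n)
  | all x r φ => all x (r - 1 / ((n : ℚ) + 1)) (φ.approx n)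

/-- The weak approximate negation; `φ.weakNeg n` is the formula usually written
`neg(φ, n+1)`. -/
def weakNeg (n : ℕ) : PBFormula Ω → PBFormula Ω
  | normLe t r => normGe t (r + 1 / ((n : ℚ) + 1))
  | normGe t r => normLe t (r - 1 / ((n : ℚ) + 1))
  | relLe R ts r => relGe R ts (r + 1 / ((n : ℚ) + 1))
  | relGe R ts r => relLe R ts (r - 1 / ((n : ℚ) + 1))
  | and φ ψ => or (φ.weakNeg n) (ψ.weakNeg n)
  | or φ ψ => and (φ.weakNeg n) (ψ.weakNeg n)
  | inf φ => bigOr (fun i => (φ i).weakNeg n) n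
  | ex x r φ => all x (r + 1 / ((n : ℚ) + 1)) (φ.weakNeg n)
  | all x r φ => ex x (r - 1 / ((n : ℚ) + 1)) (φ.weakNeg n)

theorem bigAnd_freeVars_finite {φ : ℕ → PBFormula Ω} (h : ∀ i, (φ i).freeVars.Finite) :
    ∀ n, (bigAnd φ n).freeVars.Finite
  | 0 => h 0
  | n + 1 => (bigAnd_freeVars_finite h n).union (h (n + 1))

/-- Each approximate formula has finitely many free variables (so the index `maxIndex` below is
a genuine maximum). -/
theorem approx_freeVars_finite (n : ℕ) (φ : PBFormula Ω) : (φ.approx n).freeVars.Finite := by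
  induction φ with
  | normLe t r => exact t.vars_finite
  | normGe t r => exact t.vars_finite
  | relLe R ts r => exact Set.finite_iUnion fun k => (ts k).vars_finite
  | relGe R ts r => exact Set.finite_iUnion fun k => (ts k).vars_finite
  | and φ ψ hφ hψ => exact hφ.union hψ
  | or φ ψ hφ hψ => exact hφ.union hψ
  | inf φ ih => exact bigAnd_freeVars_finite ih n
  | ex x r φ ih => exact ih.sdiff
  | all x r φ ih => exact ih.sdiff

/-- For the variables `y₁ = v 0, y₂ = v 1, …`: the largest `j` such that `y_j` is free in `φ`,
and `0` if there is none. -/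
noncomputable def maxIndex (v : ℕ ↪ ℕ) (φ : PBFormula Ω) : ℕ :=
  sSup {j | ∃ i, v i ∈ φ.freeVars ∧ j = i + 1}

/-- `∃ y₁ (‖y₁‖ ≤ r₁ ∧ … ∃ y_k (‖y_k‖ ≤ r_k ∧ φ) …)`, where `y_{i+1} = v i` and
`r_{i+1} = r i`. -/
def exBlock (v : ℕ ↪ ℕ) (r : ℕ → ℚ) : ℕ → PBFormula Ω → PBFormula Ω
  | 0, φ => φ
  | k + 1, φ => exBlock v r k (ex (v k) (r k) φ)

end PBFormula

/-- Formulas of the infinitary logic `L_A`; the conditions on quantifier bounds are in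
`LAFormula.WellFormed`. -/
inductive LAFormula (Ω : Signature.{u}) : Type u where
  | pb (φ : PBFormula Ω) : LAFormula Ω
  /-- the conjunction of the `n + 1` formulas `φ 0, …, φ n` -/
  | finConj (n : ℕ) (φ : Fin (n + 1) → LAFormula Ω) : LAFormula Ω
  /-- the countable conjunction of `φ 0, φ 1, φ 2, …` -/
  | conj (φ : ℕ → LAFormula Ω) : LAFormula Ω
  | neg (φ : LAFormula Ω) : LAFormula Ω
  /-- `∃ (v 0, v 1, …) (⋀ i, ‖v i‖ ≤ r i ∧ φ)`, with distinct variables `v i` -/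
  | ex (v : ℕ ↪ ℕ) (r : ℕ → ℚ) (φ : LAFormula Ω) : LAFormula Ω

namespace LAFormula

variable {Ω : Signature.{u}}

def WellFormed : LAFormula Ω → Prop
  | pb φ => φ.WellFormed
  | finConj _ φ => ∀ i, (φ i).WellFormed
  | conj φ => ∀ i, (φ i).WellFormed
  | neg φ => φ.WellFormed
  | ex _ r φ => (∀ i, 0 ≤ r i) ∧ φ.WellFormed

def freeVars : LAFormula Ω → Set ℕ
  | pb φ => φ.freeVars
  | finConj _ φ => ⋃ i, (φ i).freeVars
  | conj φ => ⋃ i, (φ i).freeVars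
  | neg φ => φ.freeVars
  | ex v _ φ => φ.freeVars \ Set.range v

/-- `φ` is a sentence of `L_A`. -/
def IsSentence (φ : LAFormula Ω) : Prop :=
  φ.WellFormed ∧ φ.freeVars = ∅

/-- Satisfaction `E ⊨ φ(a)`.  `Function.extend v y a` is the assignment with value `y i` at `v i`
and value `a x` at every variable `x` that is not of the form `v i`. -/
def Sat (E : NormedStructure.{u, w} Ω) : LAFormula Ω → (ℕ → E.carrier) → Prop
  | pb φ, a => φ.Sat E a
  | finConj _ φ, a => ∀ i, (φ i).Sat E a
  | conj φ, a => ∀ i, (φ i).Sat E a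
  | neg φ, a => ¬ φ.Sat E a
  | ex v r φ, a => ∃ y : ℕ → E.carrier,
      (∀ i, ‖y i‖ ≤ ((r i : ℚ) : ℝ)) ∧ φ.Sat E (Function.extend v y a)

/-- The set `I(φ)` of branches of `φ` together with the map `h ↦ [φ]_h`, by simultaneous
recursion. -/
noncomputable def tree : LAFormula Ω → (I : Type) × (I → PBFormula Ω)
  | pb φ => ⟨Unit, fun _ => φ⟩
  | finConj n φ =>
      ⟨∀ i : Fin (n + 1), (φ i).tree.1,
        fun h => PBFormula.bigAnd
          (fun i => (φ (Fin.ofNat (n + 1) i)).tree.2 (h (Fin.ofNat (n + 1) i))) n⟩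
  | conj φ =>
      ⟨∀ i : ℕ, (φ i).tree.1, fun h => PBFormula.inf (fun i => (φ i).tree.2 (h i))⟩
  | neg φ =>
      ⟨{f : ℕ → φ.tree.1 × ℕ // ∀ h : φ.tree.1, ∃ s : ℕ,
          (φ.tree.2 h).approx (f s).2 = (φ.tree.2 (f s).1).approx (f s).2},
        fun f => PBFormula.inf (fun s => (φ.tree.2 (f.1 s).1).weakNeg (f.1 s).2)⟩
  | ex v r φ =>
      ⟨φ.tree.1, fun h => PBFormula.inf (fun n =>
        PBFormula.exBlock v r (PBFormula.maxIndex v ((φ.tree.2 h).approx n))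
          ((φ.tree.2 h).approx n))⟩

/-- The set `I(φ)` of branches. -/
def Branch (φ : LAFormula Ω) : Type := φ.tree.1

/-- The formula `[φ]_h`. -/
noncomputable def along (φ : LAFormula Ω) (h : φ.Branch) : PBFormula Ω := φ.tree.2 h

/-- Approximate satisfaction `E ⊨_AP φ(a)`. -/
def ApproxSat (E : NormedStructure.{u, w} Ω) (φ : LAFormula Ω) (a : ℕ → E.carrier) : Prop :=
  ∃ h : φ.Branch, ∀ n : ℕ, ((φ.along h).approx n).Sat E a

end LAFormula

/-- Approximate finite consistency of a collection `Θ` of sentences.  (The formulas involved have no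
free variables, so "for every assignment `a`" is just truth in `E`.) -/
def ApproxFinConsistent {Ω : Signature.{u}} (Θ : Set (LAFormula Ω)) : Prop :=
  ∃ h : ∀ σ : Θ, (σ : LAFormula Ω).Branch, ∀ (F : Finset Θ) (n : ℕ),
    ∃ E : NormedStructure.{u, w} Ω, ∀ σ ∈ F, ∀ a : ℕ → E.carrier,
      (((σ : LAFormula Ω).along (h σ)).approx n).Sat E a

end ApproxTruth

/-!
The model is the ultraproduct, along a nonprincipal ultrafilter on `ℕ`, of structures `M k`
satisfying more and more of the approximations `([σ]_{h(σ)})_n`.  A sequence suffices even when the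
set of sentences is uncountable, since a countable signature has only countably many approximations
(`ApproxFinConsistent.exists_sequence`).

Łoś's theorem holds up to a change of level: for `n < m`, truth of `φ_m` in the ultraproduct gives
truth of `φ_n` in almost all factors, and conversely (`PBFormula.los`).  This requires no positivity
of the quantifier bounds, because the strict gap between the levels absorbs the difference between a
limit of norms and the norms themselves.  It yields approximate truth of the given sentences.

To pass to truth, a diagonal argument shows that the ultraproduct is countably saturated with
respect to approximations (`saturated_ultraproduct`), and in every saturated structure truth and
approximate truth agree on all of `L_A` (`LAFormula.approxSat_iff_sat`), by induction on formulas: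

* For `L_PB`, saturation provides witnesses of the existential quantifiers.  It also shows that
  solution sets are closed, which extends a universal statement from the open ball to the closed
  ball; this is where universal bounds have to be positive.
* For `∃ y₁ y₂ …`, saturation combines the witnesses of the finite blocks into one sequence.
* For `¬φ`, approximate truth of `¬φ` is failure of approximate truth of `φ`, in any structure
  (`LAFormula.approxSat_neg`).  In one direction, `neg(φ, n)` is the formal dual of `φ_n`, so it
  contradicts every branch with the same approximation.  In the other direction, countability of the
  set of approximations allows a single sequence of failing pairs `(h, n)` to cover all branches.
-/

namespace ApproxTruth

/-! ### Approximations and weak negations -/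

variable {Ω : Signature.{u}}

theorem one_div_succ_anti {n m : ℕ} (h : n ≤ m) : 1 / ((m : ℝ) + 1) ≤ 1 / ((n : ℝ) + 1) :=
  one_div_le_one_div_of_le (by positivity) (by exact_mod_cast Nat.succ_le_succ h)

theorem one_div_succ_strictAnti {n m : ℕ} (h : n < m) :
    1 / ((m : ℝ) + 1) < 1 / ((n : ℝ) + 1) :=
  one_div_lt_one_div_of_lt (by positivity) (by exact_mod_cast Nat.succ_lt_succ h)

theorem exists_one_div_succ_le {ε : ℝ} (hε : 0 < ε) (N : ℕ) :
    ∃ n, N ≤ n ∧ 1 / ((n : ℝ) + 1) < ε := by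
  obtain ⟨n, hn⟩ := exists_nat_one_div_lt hε
  exact ⟨max N n, le_max_left _ _, (one_div_succ_anti (le_max_right N n)).trans_lt hn⟩

theorem le_of_forall_le_add_one_div {x y : ℝ} (h : ∀ n : ℕ, x ≤ y + 1 / ((n : ℝ) + 1)) :
    x ≤ y := by
  refine le_of_forall_pos_le_add fun ε hε => ?_
  obtain ⟨n, -, hn⟩ := exists_one_div_succ_le hε 0
  linarith [h n]

theorem Term.eval_congr (E : NormedStructure.{u, w} Ω) {a b : ℕ → E.carrier} (t : Term Ω)
    (h : ∀ x ∈ t.vars, a x = b x) : t.eval E a = t.eval E b := by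
  induction t with
  | var x => exact h x rfl
  | zero => rfl
  | add s t hs ht =>
    simp only [Term.eval]
    rw [hs fun x hx => h x (Or.inl hx), ht fun x hx => h x (Or.inr hx)]
  | smul q t ht => simp only [Term.eval]; rw [ht h]
  | func f ts ih =>
    simp only [Term.eval]
    congr 1
    funext k
    exact ih k fun x hx => h x (Set.mem_iUnion.2 ⟨k, hx⟩)

namespace PBFormula

variable (E : NormedStructure.{u, w} Ω)

theorem sat_congr (φ : PBFormula Ω) : ∀ {a b : ℕ → E.carrier},
    (∀ x ∈ φ.freeVars, a x = b x) → (φ.Sat E a ↔ φ.Sat E b) := by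
  have upd : ∀ {a b : ℕ → E.carrier} {s : Set ℕ} {x : ℕ}, (∀ z ∈ s \ {x}, a z = b z) →
      ∀ y, ∀ z ∈ s, Function.update a x y z = Function.update b x y z := by
    intro a b s x h y z hz
    by_cases hzx : z = x
    · subst hzx; simp
    · simp [hzx, h z ⟨hz, hzx⟩]
  have args : ∀ {a b : ℕ → E.carrier} {m : ℕ} (ts : Fin m → Term Ω),
      (∀ x ∈ ⋃ k, (ts k).vars, a x = b x) →
      (fun k => (ts k).eval E a) = fun k => (ts k).eval E b := by
    intro a b m ts h
    funext k
    exact Term.eval_congr E (ts k) fun x hx => h x (Set.mem_iUnion.2 ⟨k, hx⟩)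
  induction φ with
  | normLe t r => intro a b h; simp only [Sat]; rw [Term.eval_congr E t h]
  | normGe t r => intro a b h; simp only [Sat]; rw [Term.eval_congr E t h]
  | relLe R ts r => intro a b h; simp only [Sat]; rw [args ts h]
  | relGe R ts r => intro a b h; simp only [Sat]; rw [args ts h]
  | and φ ψ hφ hψ =>
    intro a b h
    exact and_congr (hφ fun x hx => h x (Or.inl hx)) (hψ fun x hx => h x (Or.inr hx))
  | or φ ψ hφ hψ =>
    intro a b h
    exact or_congr (hφ fun x hx => h x (Or.inl hx)) (hψ fun x hx => h x (Or.inr hx))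
  | inf φ ih =>
    intro a b h
    exact forall_congr' fun i => ih i fun x hx => h x (Set.mem_iUnion.2 ⟨i, hx⟩)
  | ex x r φ ih =>
    intro a b h
    exact exists_congr fun y => and_congr_right fun _ => ih (upd h y)
  | all x r φ ih =>
    intro a b h
    exact forall_congr' fun y => imp_congr_right fun _ => ih (upd h y)

variable {E}

theorem sat_bigAnd {φ : ℕ → PBFormula Ω} {n : ℕ} {a : ℕ → E.carrier} :
    (bigAnd φ n).Sat E a ↔ ∀ i ≤ n, (φ i).Sat E a := by
  induction n with
  | zero => simp [bigAnd]
  | succ n ih =>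
    simp only [bigAnd, Sat, ih, Nat.le_succ_iff, or_imp, forall_and, forall_eq]

theorem sat_bigOr {φ : ℕ → PBFormula Ω} {n : ℕ} {a : ℕ → E.carrier} :
    (bigOr φ n).Sat E a ↔ ∃ i ≤ n, (φ i).Sat E a := by
  induction n with
  | zero => simp [bigOr]
  | succ n ih =>
    simp only [bigOr, Sat, ih, Nat.le_succ_iff, or_and_right, exists_or, exists_eq_left]

theorem approx_bigAnd (φ : ℕ → PBFormula Ω) (n m : ℕ) :
    (bigAnd φ n).approx m = bigAnd (fun i => (φ i).approx m) n := by
  induction n with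
  | zero => rfl
  | succ n ih => simp only [bigAnd, approx, ih]

theorem approx_bigOr (φ : ℕ → PBFormula Ω) (n m : ℕ) :
    (bigOr φ n).approx m = bigOr (fun i => (φ i).approx m) n := by
  induction n with
  | zero => rfl
  | succ n ih => simp only [bigOr, approx, ih]

/-- A formula implies its approximations. -/
theorem Sat.approx {φ : PBFormula Ω} {a : ℕ → E.carrier} (h : φ.Sat E a) (n : ℕ) :
    (φ.approx n).Sat E a := by
  have hpos : (0 : ℝ) < 1 / ((n : ℝ) + 1) := by positivity
  induction φ generalizing a with
  | normLe t r => simp only [PBFormula.approx, Sat] at h ⊢; push_cast; linarith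
  | normGe t r => simp only [PBFormula.approx, Sat] at h ⊢; push_cast; linarith
  | relLe R ts r => simp only [PBFormula.approx, Sat] at h ⊢; push_cast; linarith
  | relGe R ts r => simp only [PBFormula.approx, Sat] at h ⊢; push_cast; linarith
  | and φ ψ hφ hψ => exact ⟨hφ h.1, hψ h.2⟩
  | or φ ψ hφ hψ => exact h.imp hφ hψ
  | inf φ ih => exact sat_bigAnd.2 fun i _ => ih i (h i)
  | ex x r φ ih =>
    obtain ⟨y, hy, hφ⟩ := h
    exact ⟨y, by push_cast; linarith, ih hφ⟩
  | all x r φ ih =>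
    intro y hy
    push_cast at hy
    exact ih (h y (by linarith))

/-- The approximations get stronger with the level. -/
theorem Sat.approx_anti {φ : PBFormula Ω} {a : ℕ → E.carrier} {n m : ℕ} (hnm : n ≤ m)
    (h : (φ.approx m).Sat E a) : (φ.approx n).Sat E a := by
  have hle := one_div_succ_anti hnm
  induction φ generalizing a with
  | normLe t r => simp only [PBFormula.approx, Sat] at h ⊢; push_cast at h ⊢; linarith
  | normGe t r => simp only [PBFormula.approx, Sat] at h ⊢; push_cast at h ⊢; linarith
  | relLe R ts r => simp only [PBFormula.approx, Sat] at h ⊢; push_cast at h ⊢; linarith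
  | relGe R ts r => simp only [PBFormula.approx, Sat] at h ⊢; push_cast at h ⊢; linarith
  | and φ ψ hφ hψ => exact ⟨hφ h.1, hψ h.2⟩
  | or φ ψ hφ hψ => exact h.imp hφ hψ
  | inf φ ih =>
    exact sat_bigAnd.2 fun i hi => ih i (sat_bigAnd.1 h i (hi.trans hnm))
  | ex x r φ ih =>
    obtain ⟨y, hy, hφ⟩ := h
    exact ⟨y, by push_cast at hy ⊢; linarith, ih hφ⟩
  | all x r φ ih =>
    intro y hy
    exact ih (h y (by push_cast at hy ⊢; linarith))

/-- Iterating approximations adds up the tolerances. -/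
theorem Sat.of_approx_approx {φ : PBFormula Ω} {a : ℕ → E.carrier} {k n m : ℕ} (hkn : k ≤ n)
    (hle : 1 / ((n : ℝ) + 1) + 1 / ((m : ℝ) + 1) ≤ 1 / ((k : ℝ) + 1))
    (h : ((φ.approx n).approx m).Sat E a) : (φ.approx k).Sat E a := by
  induction φ generalizing a with
  | normLe t r => simp only [PBFormula.approx, Sat] at h ⊢; push_cast at h ⊢; linarith
  | normGe t r => simp only [PBFormula.approx, Sat] at h ⊢; push_cast at h ⊢; linarith
  | relLe R ts r => simp only [PBFormula.approx, Sat] at h ⊢; push_cast at h ⊢; linarith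
  | relGe R ts r => simp only [PBFormula.approx, Sat] at h ⊢; push_cast at h ⊢; linarith
  | and φ ψ hφ hψ => exact ⟨hφ h.1, hψ h.2⟩
  | or φ ψ hφ hψ => exact h.imp hφ hψ
  | inf φ ih =>
    simp only [PBFormula.approx, approx_bigAnd] at h ⊢
    exact sat_bigAnd.2 fun i hi => ih i (sat_bigAnd.1 h i (hi.trans hkn))
  | ex x r φ ih =>
    obtain ⟨y, hy, hφ⟩ := h
    exact ⟨y, by push_cast at hy ⊢; linarith, ih hφ⟩
  | all x r φ ih =>
    intro y hy
    exact ih (h y (by push_cast at hy ⊢; linarith))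

theorem sat_weakNeg_of_not_sat_approx {φ : PBFormula Ω} {a : ℕ → E.carrier} {n : ℕ}
    (h : ¬ (φ.approx n).Sat E a) : (φ.weakNeg n).Sat E a := by
  induction φ generalizing a with
  | normLe t r => exact (not_le.1 h).le
  | normGe t r => exact (not_le.1 h).le
  | relLe R ts r => exact (not_le.1 h).le
  | relGe R ts r => exact (not_le.1 h).le
  | and φ ψ hφ hψ => exact (not_and_or.1 h).imp hφ hψ
  | or φ ψ hφ hψ => exact ⟨hφ fun h' => h (Or.inl h'), hψ fun h' => h (Or.inr h')⟩
  | inf φ ih =>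
    have h' := mt sat_bigAnd.2 h
    push Not at h'
    obtain ⟨i, hi, hφ⟩ := h'
    exact sat_bigOr.2 ⟨i, hi, ih i hφ⟩
  | ex x r φ ih => exact fun y hy => ih fun h' => h ⟨y, hy, h'⟩
  | all x r φ ih =>
    simp only [PBFormula.approx, Sat] at h
    push Not at h
    obtain ⟨y, hy, hφ⟩ := h
    exact ⟨y, hy, ih hφ⟩

/-- Sufficiently good approximations of a formula and of one of its weak negations exclude each
other. -/
theorem not_sat_approx_weakNeg {φ : PBFormula Ω} {a : ℕ → E.carrier} {n m k : ℕ} (hnm : n ≤ m)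
    (hlt : 1 / ((m : ℝ) + 1) + 1 / ((k : ℝ) + 1) < 1 / ((n : ℝ) + 1))
    (h : (φ.approx m).Sat E a) : ¬ ((φ.weakNeg n).approx k).Sat E a := by
  intro h'
  induction φ generalizing a with
  | normLe t r => simp only [weakNeg, PBFormula.approx, Sat] at h h'; push_cast at h h'; linarith
  | normGe t r => simp only [weakNeg, PBFormula.approx, Sat] at h h'; push_cast at h h'; linarith
  | relLe R ts r => simp only [weakNeg, PBFormula.approx, Sat] at h h'; push_cast at h h'; linarith
  | relGe R ts r => simp only [weakNeg, PBFormula.approx, Sat] at h h'; push_cast at h h'; linarith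
  | and φ ψ hφ hψ => exact h'.elim (hφ h.1) (hψ h.2)
  | or φ ψ hφ hψ => exact h.elim (fun h => hφ h h'.1) (fun h => hψ h h'.2)
  | inf φ ih =>
    simp only [weakNeg, approx_bigOr] at h'
    obtain ⟨i, hi, hφ⟩ := sat_bigOr.1 h'
    exact ih i (sat_bigAnd.1 h i (hi.trans hnm)) hφ
  | ex x r φ ih =>
    obtain ⟨y, hy, hφ⟩ := h
    exact ih hφ (h' y (by push_cast at hy ⊢; linarith))
  | all x r φ ih =>
    obtain ⟨y, hy, hφ⟩ := h'
    exact ih (h y (by push_cast at hy ⊢; linarith)) hφ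

/-- The formal dual: reverse the inequalities and exchange `∧` with `∨` and `∃` with `∀`.  It is
used only for formulas without countable conjunctions, which is why its value on these is
immaterial. -/
def dual : PBFormula Ω → PBFormula Ω
  | normLe t r => normGe t r
  | normGe t r => normLe t r
  | relLe R ts r => relGe R ts r
  | relGe R ts r => relLe R ts r
  | and φ ψ => or φ.dual ψ.dual
  | or φ ψ => and φ.dual ψ.dual
  | inf φ => inf φ
  | ex x r φ => all x r φ.dual
  | all x r φ => ex x r φ.dual

theorem dual_bigAnd (φ : ℕ → PBFormula Ω) (n : ℕ) :
    (bigAnd φ n).dual = bigOr (fun i => (φ i).dual) n := by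
  induction n with
  | zero => rfl
  | succ n ih => simp only [bigAnd, bigOr, dual, ih]

/-- The weak negation `neg(φ, n)` depends only on the approximation `φ_n`. -/
theorem dual_approx (φ : PBFormula Ω) (n : ℕ) : (φ.approx n).dual = φ.weakNeg n := by
  induction φ with
  | normLe t r => rfl
  | normGe t r => rfl
  | relLe R ts r => rfl
  | relGe R ts r => rfl
  | and φ ψ hφ hψ => simp only [approx, dual, weakNeg, hφ, hψ]
  | or φ ψ hφ hψ => simp only [approx, dual, weakNeg, hφ, hψ]
  | inf φ ih => simp only [approx, dual_bigAnd, weakNeg, ih]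
  | ex x r φ ih => simp only [approx, dual, weakNeg, ih]
  | all x r φ ih => simp only [approx, dual, weakNeg, ih]

theorem sat_inf_approx_iff {φ : ℕ → PBFormula Ω} {a : ℕ → E.carrier} :
    (∀ n, ((inf φ).approx n).Sat E a) ↔ ∀ i n, ((φ i).approx n).Sat E a := by
  refine ⟨fun h i n => ?_, fun h n => sat_bigAnd.2 fun i _ => h i n⟩
  exact (sat_bigAnd.1 (h (max i n)) i (le_max_left _ _)).approx_anti (le_max_right _ _)

theorem approx_freeVars_subset (n : ℕ) (φ : PBFormula Ω) :
    (φ.approx n).freeVars ⊆ φ.freeVars := by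
  have hbig : ∀ (ψ : ℕ → PBFormula Ω) (k : ℕ), (bigAnd ψ k).freeVars ⊆ ⋃ i, (ψ i).freeVars := by
    intro ψ k
    induction k with
    | zero => exact Set.subset_iUnion (fun i => (ψ i).freeVars) 0
    | succ k ih =>
      exact Set.union_subset ih (Set.subset_iUnion (fun i => (ψ i).freeVars) (k + 1))
  induction φ with
  | normLe t r => exact subset_rfl
  | normGe t r => exact subset_rfl
  | relLe R ts r => exact subset_rfl
  | relGe R ts r => exact subset_rfl
  | and φ ψ hφ hψ => exact Set.union_subset_union hφ hψ
  | or φ ψ hφ hψ => exact Set.union_subset_union hφ hψ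
  | inf φ ih => exact (hbig _ n).trans (Set.iUnion_mono ih)
  | ex x r φ ih => exact Set.sdiff_subset_sdiff_left ih
  | all x r φ ih => exact Set.sdiff_subset_sdiff_left ih

/-! ### Blocks of existential quantifiers -/

theorem approx_exBlock (v : ℕ ↪ ℕ) (r : ℕ → ℚ) (k n : ℕ) (φ : PBFormula Ω) :
    (exBlock v r k φ).approx n =
      exBlock v (fun i => r i + 1 / ((n : ℚ) + 1)) k (φ.approx n) := by
  induction k generalizing φ with
  | zero => rfl
  | succ k ih => simp only [exBlock, ih, approx]

theorem sat_exBlock {v : ℕ ↪ ℕ} {r : ℕ → ℚ} {k : ℕ} {φ : PBFormula Ω} {a : ℕ → E.carrier} :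
    (exBlock v r k φ).Sat E a ↔ ∃ b : ℕ → E.carrier, (∀ i < k, ‖b (v i)‖ ≤ (r i : ℝ)) ∧
      (∀ x, (∀ i < k, x ≠ v i) → b x = a x) ∧ φ.Sat E b := by
  induction k generalizing φ with
  | zero =>
    refine ⟨fun h => ⟨a, by simp, by simp, h⟩, fun ⟨b, _, hb, h⟩ => ?_⟩
    have : b = a := funext fun x => hb x (by simp)
    exact this ▸ h
  | succ k ih =>
    simp only [exBlock, ih, Sat]
    constructor
    · rintro ⟨b, hb, hba, y, hy, h⟩
      refine ⟨Function.update b (v k) y, fun i hi => ?_, fun x hx => ?_, h⟩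
      · rcases Nat.lt_succ_iff_lt_or_eq.1 hi with hi | rfl
        · rw [Function.update_of_ne (v.injective.ne hi.ne)]
          exact hb i hi
        · simpa using hy
      · rw [Function.update_of_ne (hx k k.lt_succ_self)]
        exact hba x fun i hi => hx i (hi.trans k.lt_succ_self)
    · rintro ⟨b, hb, hba, h⟩
      refine ⟨Function.update b (v k) (a (v k)), fun i hi => ?_, fun x hx => ?_, b (v k),
        hb k k.lt_succ_self, ?_⟩
      · rw [Function.update_of_ne (v.injective.ne hi.ne)]
        exact hb i (hi.trans k.lt_succ_self)
      · by_cases hxk : x = v k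
        · subst hxk; simp
        · rw [Function.update_of_ne hxk]
          refine hba x fun i hi => ?_
          rcases Nat.lt_succ_iff_lt_or_eq.1 hi with hi | rfl
          exacts [hx i hi, hxk]
      · simpa using h

theorem lt_maxIndex {v : ℕ ↪ ℕ} {φ : PBFormula Ω} (hφ : φ.freeVars.Finite) {i : ℕ}
    (hi : v i ∈ φ.freeVars) : i < maxIndex v φ := by
  refine Nat.lt_of_succ_le (le_csSup ?_ ⟨i, hi, rfl⟩)
  refine Set.Finite.bddAbove (((hφ.preimage v.injective.injOn).image Nat.succ).subset ?_)
  rintro j ⟨i, hi, rfl⟩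
  exact ⟨i, hi, rfl⟩

end PBFormula

/-! ### Countability of the set of approximations -/

/-- The labels of the syntax trees of terms. -/
abbrev Term.Label (Ω : Signature.{u}) : Type u := ℕ ⊕ Unit ⊕ Unit ⊕ ℚ ⊕ (Σ m, Ω.Func m)

/-- The number of immediate subterms of a term whose outermost symbol has the given label. -/
def Term.arity : Term.Label Ω → ℕ :=
  Sum.elim (fun _ => 0) <| Sum.elim (fun _ => 0) <| Sum.elim (fun _ => 2) <|
    Sum.elim (fun _ => 1) Sigma.fst

/-- The term with a given syntax tree. -/
def Term.ofTree : (WType fun l : Term.Label Ω => Fin (Term.arity l)) → Term Ω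
  | ⟨.inl x, _⟩ => var x
  | ⟨.inr (.inl _), _⟩ => zero
  | ⟨.inr (.inr (.inl _)), c⟩ => add (ofTree (c (0 : Fin 2))) (ofTree (c (1 : Fin 2)))
  | ⟨.inr (.inr (.inr (.inl q))), c⟩ => smul q (ofTree (c (0 : Fin 1)))
  | ⟨.inr (.inr (.inr (.inr f))), c⟩ => func f.2 fun k => ofTree (c k)

theorem Term.ofTree_surjective : Function.Surjective (Term.ofTree (Ω := Ω)) := by
  intro t
  induction t with
  | var x => exact ⟨⟨.inl x, Fin.elim0⟩, rfl⟩
  | zero => exact ⟨⟨.inr (.inl ()), Fin.elim0⟩, rfl⟩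
  | add s t hs ht =>
    obtain ⟨s, rfl⟩ := hs
    obtain ⟨t, rfl⟩ := ht
    exact ⟨⟨.inr (.inr (.inl ())), (![s, t] : Fin 2 → _)⟩, rfl⟩
  | smul q t ht =>
    obtain ⟨t, rfl⟩ := ht
    exact ⟨⟨.inr (.inr (.inr (.inl q))), fun _ : Fin 1 => t⟩, rfl⟩
  | func f ts ih =>
    choose c hc using ih
    obtain rfl : (fun k => ofTree (c k)) = ts := funext hc
    exact ⟨⟨.inr (.inr (.inr (.inr ⟨_, f⟩))), c⟩, rfl⟩

theorem Signature.IsCountable.countable_term (hΩ : Ω.IsCountable) : Countable (Term Ω) := by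
  have := hΩ.1
  have : Encodable (Term.Label Ω) := Encodable.ofCountable _
  exact Term.ofTree_surjective.countable

namespace PBFormula

/-- The labels of the syntax trees of formulas without countable conjunctions: an atomic formula,
`∧` or `∨`, or `∃` or `∀` with its variable and bound.  In each case the Boolean `true` marks the
first of the two alternatives. -/
abbrev Label (Ω : Signature.{u}) : Type u :=
  ((Bool × (Term Ω ⊕ Σ m, Ω.Rel m × (Fin m → Term Ω))) × ℚ) ⊕ Bool ⊕ (Bool × ℕ × ℚ)

/-- The number of immediate subformulas of a formula with the given label. -/
def arity : Label Ω → ℕ := Sum.elim (fun _ => 0) <| Sum.elim (fun _ => 2) fun _ => 1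

/-- The formula with a given syntax tree. -/
def ofTree : (WType fun l : Label Ω => Fin (arity l)) → PBFormula Ω
  | ⟨.inl ((true, .inl t), r), _⟩ => normLe t r
  | ⟨.inl ((false, .inl t), r), _⟩ => normGe t r
  | ⟨.inl ((true, .inr R), r), _⟩ => relLe R.2.1 R.2.2 r
  | ⟨.inl ((false, .inr R), r), _⟩ => relGe R.2.1 R.2.2 r
  | ⟨.inr (.inl true), c⟩ => and (ofTree (c (0 : Fin 2))) (ofTree (c (1 : Fin 2)))
  | ⟨.inr (.inl false), c⟩ => or (ofTree (c (0 : Fin 2))) (ofTree (c (1 : Fin 2)))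
  | ⟨.inr (.inr (true, x, r)), c⟩ => ex x r (ofTree (c (0 : Fin 1)))
  | ⟨.inr (.inr (false, x, r)), c⟩ => all x r (ofTree (c (0 : Fin 1)))

theorem approx_mem_range_ofTree (n : ℕ) (φ : PBFormula Ω) : φ.approx n ∈ Set.range ofTree := by
  have mem_and : ∀ {φ ψ : PBFormula Ω}, φ ∈ Set.range ofTree → ψ ∈ Set.range ofTree →
      and φ ψ ∈ Set.range ofTree := by
    rintro _ _ ⟨s, rfl⟩ ⟨t, rfl⟩
    exact ⟨⟨.inr (.inl true), (![s, t] : Fin 2 → _)⟩, rfl⟩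
  induction φ with
  | normLe t r => exact ⟨⟨.inl ((true, .inl t), _), Fin.elim0⟩, rfl⟩
  | normGe t r => exact ⟨⟨.inl ((false, .inl t), _), Fin.elim0⟩, rfl⟩
  | relLe R ts r => exact ⟨⟨.inl ((true, .inr ⟨_, R, ts⟩), _), Fin.elim0⟩, rfl⟩
  | relGe R ts r => exact ⟨⟨.inl ((false, .inr ⟨_, R, ts⟩), _), Fin.elim0⟩, rfl⟩
  | and φ ψ hφ hψ => exact mem_and hφ hψ
  | or φ ψ hφ hψ =>
    obtain ⟨s, hs⟩ := hφ
    obtain ⟨t, ht⟩ := hψ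
    rw [approx, ← hs, ← ht]
    exact ⟨⟨.inr (.inl false), (![s, t] : Fin 2 → _)⟩, rfl⟩
  | inf φ ih =>
    have : ∀ k, bigAnd (fun i => (φ i).approx n) k ∈ Set.range ofTree := fun k => by
      induction k with
      | zero => exact ih 0
      | succ k hk => exact mem_and hk (ih (k + 1))
    exact this n
  | ex x r φ ih =>
    obtain ⟨s, hs⟩ := ih
    rw [approx, ← hs]
    exact ⟨⟨.inr (.inr (true, x, _)), fun _ : Fin 1 => s⟩, rfl⟩
  | all x r φ ih =>
    obtain ⟨s, hs⟩ := ih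
    rw [approx, ← hs]
    exact ⟨⟨.inr (.inr (false, x, _)), fun _ : Fin 1 => s⟩, rfl⟩

/-- Over a countable signature there are only countably many approximations, although there may be
uncountably many formulas. -/
theorem countable_range_ofTree (hΩ : Ω.IsCountable) :
    (Set.range (ofTree (Ω := Ω))).Countable := by
  have := hΩ.2
  have := hΩ.countable_term
  have : Encodable (Label Ω) := Encodable.ofCountable _
  exact Set.countable_range _

end PBFormula

/-! ### Truth and approximate truth in saturated structures -/

/-- Countable saturation with respect to approximations.  If for every `n` some assignment satisfies
`χ_n` and lies within `r x + 1/(n+1)` of `c x` at each variable `x`, then a single assignment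
satisfies all `χ_n` and lies within `r x` of `c x` at each `x`.  The radius `0` fixes the value of a
variable, or says that a limit of values is again a solution; the centre `0` gives the bound of an
existential quantifier. -/
def NormedStructure.Saturated (E : NormedStructure.{u, w} Ω) : Prop :=
  ∀ (χ : PBFormula Ω) (c : ℕ → E.carrier) (r : ℕ → ℝ),
    (∀ n : ℕ, ∃ b : ℕ → E.carrier, (∀ x, ‖b x - c x‖ ≤ r x + 1 / ((n : ℝ) + 1)) ∧
      (χ.approx n).Sat E b) →
    ∃ b : ℕ → E.carrier, (∀ x, ‖b x - c x‖ ≤ r x) ∧ ∀ n, (χ.approx n).Sat E b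

namespace PBFormula

variable {E : NormedStructure.{u, w} Ω}

/-- In a saturated structure, the formulas of `L_PB` are closed: they follow from their
approximations. -/
theorem sat_of_forall_sat_approx (hE : E.Saturated) {φ : PBFormula Ω} (hφ : φ.WellFormed)
    {a : ℕ → E.carrier} (h : ∀ n, (φ.approx n).Sat E a) : φ.Sat E a := by
  induction φ generalizing a with
  | normLe t r =>
    refine le_of_forall_le_add_one_div fun n => ?_
    have := h n
    simp only [approx, Sat] at this
    push_cast at this
    exact this
  | normGe t r =>
    refine le_of_forall_le_add_one_div fun n => ?_
    have := h n
    simp only [approx, Sat] at this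
    push_cast at this
    linarith
  | relLe R ts r =>
    refine le_of_forall_le_add_one_div fun n => ?_
    have := h n
    simp only [approx, Sat] at this
    push_cast at this
    exact this
  | relGe R ts r =>
    refine le_of_forall_le_add_one_div fun n => ?_
    have := h n
    simp only [approx, Sat] at this
    push_cast at this
    linarith
  | and φ ψ ihφ ihψ => exact ⟨ihφ hφ.1 fun n => (h n).1, ihψ hφ.2 fun n => (h n).2⟩
  | or φ ψ ihφ ihψ =>
    by_cases hall : ∀ n, (φ.approx n).Sat E a
    · exact Or.inl (ihφ hφ.1 hall)
    · push Not at hall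
      obtain ⟨m, hm⟩ := hall
      refine Or.inr (ihψ hφ.2 fun n => ?_)
      rcases h (max n m) with h | h
      · exact absurd (h.approx_anti (le_max_right n m)) hm
      · exact h.approx_anti (le_max_left n m)
  | inf φ ih => exact fun i => ih i (hφ i) (sat_inf_approx_iff.1 h i)
  | ex x r φ ih =>
    obtain ⟨b, hb, hsat⟩ := hE φ (Function.update a x 0) (Function.update (fun _ => 0) x (r : ℝ))
      (fun n => by
        obtain ⟨y, hy, hφ⟩ := h n
        refine ⟨_, fun z => ?_, hφ⟩
        by_cases hz : z = x
        · subst hz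
          push_cast at hy
          simpa using hy
        · simp [hz]
          positivity)
    have hb' : b = Function.update a x (b x) := by
      funext z
      by_cases hz : z = x
      · subst hz; simp
      · simpa [hz, sub_eq_zero] using hb z
    refine ⟨b x, by simpa using hb x, ?_⟩
    rw [← hb']
    exact ih hφ.2 hsat
  | all x r φ ih =>
    intro y hy
    have hr : (0 : ℝ) < r := by exact_mod_cast hφ.1
    -- The points `(1 - ε) • y` lie strictly inside the ball of radius `r`, so they satisfy all
    -- approximations of `φ`, and they tend to `y`.
    have hlt : ∀ z : E.carrier, ‖z‖ < r → ∀ n, (φ.approx n).Sat E (Function.update a x z) := by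
      intro z hz n
      obtain ⟨m, hnm, hm⟩ := exists_one_div_succ_le (sub_pos.2 hz) n
      exact Sat.approx_anti hnm (h m z (by push_cast; linarith))
    obtain ⟨b, hb, hsat⟩ := hE φ (Function.update a x y) (fun _ => 0) (fun n => by
      obtain ⟨m, hnm, hm⟩ := exists_one_div_succ_le
        (show 0 < (1 / ((n : ℝ) + 1)) / r by positivity) n
      have hm1 : 1 / ((m : ℝ) + 1) ≤ 1 := by
        simpa using one_div_succ_anti (Nat.zero_le m)
      have hm0 : 0 < 1 / ((m : ℝ) + 1) := by positivity
      refine ⟨Function.update a x ((1 - 1 / ((m : ℝ) + 1)) • y), fun z => ?_, hlt _ ?_ n⟩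
      · by_cases hz : z = x
        · subst hz
          rw [lt_div_iff₀ hr] at hm
          rw [Function.update_self, Function.update_self, sub_smul, one_smul, sub_sub_cancel_left,
            norm_neg, norm_smul, Real.norm_of_nonneg hm0.le, zero_add]
          exact (mul_le_mul_of_nonneg_left hy hm0.le).trans hm.le
        · simp [hz]
          positivity
      · rw [norm_smul, Real.norm_of_nonneg (by linarith)]
        nlinarith [norm_nonneg y])
    have hb' : b = Function.update a x y := by
      funext z
      simpa [sub_eq_zero] using hb z
    exact ih hφ.2 (hb' ▸ hsat)

end PBFormula

namespace LAFormula

/-- Any set of pairs `(h, n)` that meets every branch `h` of `φ` can be thinned out to a branch of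
`¬φ`, because there are only countably many formulas `([φ]_h)_n`. -/
theorem exists_neg_branch (hΩ : Ω.IsCountable) (φ : LAFormula Ω) [Nonempty φ.Branch]
    (P : φ.Branch → ℕ → Prop) (hP : ∀ h, ∃ n, P h n) :
    ∃ f : ℕ → φ.Branch × ℕ, (∀ s, P (f s).1 (f s).2) ∧
      ∀ h, ∃ s, (φ.along h).approx (f s).2 = (φ.along (f s).1).approx (f s).2 := by
  let F : {p : φ.Branch × ℕ // P p.1 p.2} → ℕ × PBFormula Ω :=
    fun p => (p.1.2, (φ.along p.1.1).approx p.1.2)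
  have hcount : (Set.range F).Countable := by
    refine (Set.countable_univ.prod (PBFormula.countable_range_ofTree hΩ)).mono ?_
    rintro _ ⟨p, rfl⟩
    exact ⟨trivial, PBFormula.approx_mem_range_ofTree _ _⟩
  have hne : (Set.range F).Nonempty := by
    obtain ⟨h⟩ := ‹Nonempty φ.Branch›
    obtain ⟨n, hn⟩ := hP h
    exact ⟨_, ⟨(h, n), hn⟩, rfl⟩
  obtain ⟨g, hg⟩ := hcount.exists_eq_range hne
  choose p hp using fun s => (hg ▸ Set.mem_range_self s : g s ∈ Set.range F)
  refine ⟨fun s => (p s).1, fun s => (p s).2, fun h => ?_⟩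
  obtain ⟨n, hn⟩ := hP h
  obtain ⟨s, hs⟩ : F ⟨(h, n), hn⟩ ∈ Set.range g := hg ▸ Set.mem_range_self _
  rw [← hp s, Prod.ext_iff] at hs
  refine ⟨s, ?_⟩
  have h1 : (p s).1.2 = n := hs.1
  have h2 : (φ.along (p s).1.1).approx (p s).1.2 = (φ.along h).approx n := hs.2
  rw [h2, h1]

theorem nonempty_branch (hΩ : Ω.IsCountable) (φ : LAFormula Ω) : Nonempty φ.Branch := by
  induction φ with
  | pb φ => exact ⟨()⟩
  | finConj n φ ih => exact ⟨fun i => (ih i).some⟩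
  | conj φ ih => exact ⟨fun i => (ih i).some⟩
  | neg φ ih =>
    obtain ⟨f, -, hf⟩ := exists_neg_branch hΩ φ (fun _ _ => True) fun _ => ⟨0, trivial⟩
    exact ⟨⟨f, hf⟩⟩
  | ex v r φ ih => exact ih

variable {E : NormedStructure.{u, w} Ω} {a : ℕ → E.carrier}

theorem approxSat_pb {φ : PBFormula Ω} :
    (pb φ).ApproxSat E a ↔ ∀ n, (φ.approx n).Sat E a :=
  ⟨fun ⟨_, h⟩ => h, fun h => ⟨(), h⟩⟩

theorem approxSat_finConj {n : ℕ} {φ : Fin (n + 1) → LAFormula Ω} :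
    (finConj n φ).ApproxSat E a ↔ ∀ i, (φ i).ApproxSat E a := by
  have key : ∀ (h : ∀ i, (φ i).Branch) (k : ℕ),
      (((finConj n φ).along h).approx k).Sat E a ↔
        ∀ i, (((φ i).along (h i)).approx k).Sat E a := by
    intro h k
    change ((PBFormula.bigAnd _ n).approx k).Sat E a ↔ _
    rw [PBFormula.approx_bigAnd, PBFormula.sat_bigAnd]
    refine ⟨fun H i => ?_, fun H i _ => H _⟩
    have := H i (Nat.le_of_lt_succ i.2)
    rwa [show Fin.ofNat (n + 1) i = i from Fin.ofNat_val_eq_self i] at this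
  constructor
  · rintro ⟨h, H⟩ i
    exact ⟨h i, fun k => (key h k).1 (H k) i⟩
  · intro H
    choose h H using H
    exact ⟨h, fun k => (key h k).2 fun i => H i k⟩

theorem approxSat_conj {φ : ℕ → LAFormula Ω} :
    (conj φ).ApproxSat E a ↔ ∀ i, (φ i).ApproxSat E a := by
  constructor
  · rintro ⟨h, H⟩ i
    exact ⟨h i, PBFormula.sat_inf_approx_iff.1 H i⟩
  · intro H
    choose h H using H
    exact ⟨h, PBFormula.sat_inf_approx_iff.2 H⟩

/-- Approximate truth of a negation is the failure of approximate truth, in every structure. -/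
theorem approxSat_neg (hΩ : Ω.IsCountable) {φ : LAFormula Ω} :
    (neg φ).ApproxSat E a ↔ ¬ φ.ApproxSat E a := by
  constructor
  · rintro ⟨f, H⟩ ⟨h, hh⟩
    obtain ⟨s, hs⟩ := f.2 h
    -- `[φ]_h` and `[φ]_{f₁(s)}` have the same approximation, hence the same weak negation,
    -- at level `n = f₂(s)`.
    set n := (f.1 s).2
    have hneg : (φ.tree.2 (f.1 s).1).weakNeg n = (φ.tree.2 h).weakNeg n := by
      rw [← PBFormula.dual_approx, ← PBFormula.dual_approx, hs]
    have h' : ∀ k, (((φ.tree.2 h).weakNeg n).approx k).Sat E a := fun k => by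
      have := PBFormula.sat_inf_approx_iff.1 H s k
      rwa [hneg] at this
    obtain ⟨m, hnm, hm⟩ := exists_one_div_succ_le
      (show 0 < (1 / ((n : ℝ) + 1)) / 2 by positivity) n
    exact PBFormula.not_sat_approx_weakNeg hnm (by linarith) (hh m) (h' m)
  · intro H
    have := nonempty_branch hΩ φ
    obtain ⟨f, hf, hcov⟩ := exists_neg_branch hΩ φ
      (fun h n => ¬ ((φ.along h).approx n).Sat E a) fun h => by
        by_contra hcon
        push Not at hcon
        exact H ⟨h, hcon⟩
    exact ⟨⟨f, hcov⟩, PBFormula.sat_inf_approx_iff.2 fun s =>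
      (PBFormula.sat_weakNeg_of_not_sat_approx (hf s)).approx⟩

open Classical in
theorem approxSat_ex (hE : E.Saturated) {v : ℕ ↪ ℕ} {r : ℕ → ℚ} (hr : ∀ i, 0 ≤ r i)
    {φ : LAFormula Ω} :
    (ex v r φ).ApproxSat E a ↔ ∃ y : ℕ → E.carrier, (∀ i, ‖y i‖ ≤ (r i : ℝ)) ∧
      φ.ApproxSat E (Function.extend v y a) := by
  constructor
  · rintro ⟨h, H⟩
    have H' := PBFormula.sat_inf_approx_iff.1 H
    obtain ⟨b, hb, hsat⟩ := hE (φ.along h) (Function.extend v 0 a)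
      (Function.extend v (fun i => (r i : ℝ)) 0) (fun n => by
        -- Tolerances add up, so the level `2n + 1` has to be used twice to reach the level `n`.
        have hn := H' (2 * n + 1) (2 * n + 1)
        rw [PBFormula.approx_exBlock, PBFormula.sat_exBlock] at hn
        obtain ⟨b, hb, hba, hsat⟩ := hn
        set k := PBFormula.maxIndex v ((φ.tree.2 h).approx (2 * n + 1))
        have hfin := PBFormula.approx_freeVars_finite (2 * n + 1) (φ.tree.2 h)
        -- The unquantified variables `v i` with `k ≤ i` are not free, and are set to `0` to
        -- make them satisfy their bounds too.
        refine ⟨fun x => if ∃ i, k ≤ i ∧ x = v i then 0 else b x, fun x => ?_,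
          PBFormula.Sat.of_approx_approx (by lia) ?_ ((PBFormula.sat_congr E _ ?_).1 hsat)⟩
        · dsimp only
          by_cases hx : ∃ i, x = v i
          · obtain ⟨i, rfl⟩ := hx
            have hri : (0 : ℝ) ≤ r i := by exact_mod_cast hr i
            rw [v.injective.extend_apply, v.injective.extend_apply, Pi.zero_apply, sub_zero]
            split_ifs with hi
            · rw [norm_zero]; positivity
            · have hik : i < k := by
                by_contra hcon
                exact hi ⟨i, not_lt.1 hcon, rfl⟩
              refine (hb i hik).trans ?_
              have := one_div_succ_anti (show n ≤ 2 * n + 1 by lia)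
              push_cast at this ⊢
              linarith
          · have hx' : ¬ ∃ i, v i = x := fun ⟨i, hi⟩ => hx ⟨i, hi.symm⟩
            rw [if_neg fun ⟨i, _, hi⟩ => hx ⟨i, hi⟩, Function.extend_apply' _ _ _ hx',
              Function.extend_apply' _ _ _ hx', hba x fun i _ hi => hx ⟨i, hi⟩]
            simp
            positivity
        · push_cast
          refine le_of_eq ?_
          field_simp
          ring
        · intro x hx
          rw [if_neg]
          rintro ⟨i, hi, rfl⟩
          exact (PBFormula.lt_maxIndex hfin
            (PBFormula.approx_freeVars_subset _ _ hx)).not_ge hi)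
    refine ⟨fun i => b (v i), fun i => ?_, h, ?_⟩
    · simpa [v.injective.extend_apply] using hb (v i)
    · have hb' : Function.extend v (fun i => b (v i)) a = b := by
        funext x
        by_cases hx : ∃ i, v i = x
        · obtain ⟨i, rfl⟩ := hx
          rw [v.injective.extend_apply]
        · have := hb x
          rw [Function.extend_apply' _ _ _ hx, Function.extend_apply' _ _ _ hx] at this
          rw [Function.extend_apply' _ _ _ hx]
          exact (sub_eq_zero.1 (norm_le_zero_iff.1 this)).symm
      rw [hb']
      exact hsat
  · rintro ⟨y, hy, h, H⟩
    refine ⟨h, PBFormula.sat_inf_approx_iff.2 fun n => PBFormula.Sat.approx ?_⟩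
    have hfin := PBFormula.approx_freeVars_finite n (φ.tree.2 h)
    set k := PBFormula.maxIndex v ((φ.tree.2 h).approx n)
    refine PBFormula.sat_exBlock.2
      ⟨fun x => if ∃ i < k, x = v i then Function.extend v y a x else a x, fun i hi => ?_,
        fun x hx => ?_, (PBFormula.sat_congr E _ fun x hx => ?_).1 (H n)⟩
    · dsimp only
      rw [if_pos ⟨i, hi, rfl⟩, v.injective.extend_apply]
      exact hy i
    · exact if_neg fun ⟨i, hi, hxi⟩ => hx i hi hxi
    · split_ifs with hxv
      · rfl
      · refine Function.extend_apply' _ _ _ ?_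
        rintro ⟨i, rfl⟩
        exact hxv ⟨i, PBFormula.lt_maxIndex hfin hx, rfl⟩

/-- In a saturated structure, truth and approximate truth agree on `L_A`. -/
theorem approxSat_iff_sat (hΩ : Ω.IsCountable) (hE : E.Saturated) {φ : LAFormula Ω}
    (hφ : φ.WellFormed) : φ.ApproxSat E a ↔ φ.Sat E a := by
  induction φ generalizing a with
  | pb φ =>
    exact approxSat_pb.trans ⟨PBFormula.sat_of_forall_sat_approx hE hφ, fun h => h.approx⟩
  | finConj n φ ih => exact approxSat_finConj.trans (forall_congr' fun i => ih i (hφ i))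
  | conj φ ih => exact approxSat_conj.trans (forall_congr' fun i => ih i (hφ i))
  | neg φ ih => exact (approxSat_neg hΩ).trans (not_congr (ih hφ))
  | ex v r φ ih =>
    exact (approxSat_ex hE hφ.1).trans (exists_congr fun y => and_congr_right fun _ => ih hφ.2)

end LAFormula

/-! ### Ultraproducts of normed space structures -/

open Filter Topology

section Ultralimit

variable {ι : Type*} (U : Ultrafilter ι)

/-- The limit of a real-valued family along an ultrafilter; it is meaningful if the family is
bounded on a set of the ultrafilter. -/
noncomputable def ultralim (f : ι → ℝ) : ℝ := limUnder (U : Filter ι) f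

variable {U}

theorem tendsto_ultralim {f : ι → ℝ} {C : ℝ} (hf : ∀ᶠ k in U, |f k| ≤ C) :
    Tendsto f U (𝓝 (ultralim U f)) := by
  obtain ⟨l, -, hl⟩ := (isCompact_Icc (a := -C) (b := C)).ultrafilter_le_nhds (U.map f)
    (le_principal_iff.2 (hf.mono fun k hk => abs_le.1 hk))
  exact tendsto_nhds_limUnder ⟨l, hl⟩

theorem ultralim_eq {f : ι → ℝ} {l : ℝ} (hf : Tendsto f U (𝓝 l)) : ultralim U f = l :=
  hf.limUnder_eq

end Ultralimit

variable (U : Ultrafilter ℕ) (M : ℕ → NormedStructure.{u, w} Ω)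

/-- The families of points of the structures `M k` that are bounded on a set of the ultrafilter. -/
def boundedSubmodule : Submodule ℝ (∀ k, (M k).carrier) where
  carrier := {x | ∃ C : ℝ, ∀ᶠ k in U, ‖x k‖ ≤ C}
  zero_mem' := ⟨0, by simp⟩
  add_mem' := by
    rintro x y ⟨C, hC⟩ ⟨D, hD⟩
    refine ⟨C + D, ?_⟩
    filter_upwards [hC, hD] with k hk hk'
    exact (norm_add_le _ _).trans (add_le_add hk hk')
  smul_mem' := by
    rintro c x ⟨C, hC⟩
    refine ⟨‖c‖ * C, ?_⟩
    filter_upwards [hC] with k hk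
    rw [Pi.smul_apply, norm_smul]
    exact mul_le_mul_of_nonneg_left hk (norm_nonneg c)

/-- The space of bounded families, with the seminorm `lim_U ‖x k‖`. -/
def BoundedFamily : Type w := boundedSubmodule U M

namespace BoundedFamily

instance : AddCommGroup (BoundedFamily U M) :=
  inferInstanceAs (AddCommGroup (boundedSubmodule U M))

instance : Module ℝ (BoundedFamily U M) :=
  inferInstanceAs (Module ℝ (boundedSubmodule U M))

variable {U M}

/-- The `k`-th member of a bounded family. -/
def val (x : BoundedFamily U M) (k : ℕ) : (M k).carrier := x.1 k

noncomputable instance : Norm (BoundedFamily U M) := ⟨fun x => ultralim U fun k => ‖x.val k‖⟩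

theorem exists_bound (x : BoundedFamily U M) : ∃ C : ℝ, ∀ᶠ k in U, ‖x.val k‖ ≤ C := x.2

theorem val_add (x y : BoundedFamily U M) (k : ℕ) : (x + y).val k = x.val k + y.val k := rfl

theorem val_smul (c : ℝ) (x : BoundedFamily U M) (k : ℕ) : (c • x).val k = c • x.val k := rfl

theorem tendsto_norm (x : BoundedFamily U M) :
    Tendsto (fun k => ‖x.val k‖) U (𝓝 ‖x‖) := by
  obtain ⟨C, hC⟩ := x.exists_bound
  exact tendsto_ultralim (C := C) (by simpa using hC)

theorem core : SeminormedSpace.Core ℝ (BoundedFamily U M) where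
  norm_nonneg x := ge_of_tendsto' x.tendsto_norm fun k => norm_nonneg _
  norm_smul c x := ultralim_eq (by
    simpa only [val_smul, norm_smul] using x.tendsto_norm.const_mul ‖c‖)
  norm_triangle x y := le_of_tendsto_of_tendsto' (x + y).tendsto_norm
    (x.tendsto_norm.add y.tendsto_norm) fun k => norm_add_le _ _

noncomputable instance : SeminormedAddCommGroup (BoundedFamily U M) :=
  SeminormedAddCommGroup.ofCore core

noncomputable instance : NormedSpace ℝ (BoundedFamily U M) where
  norm_smul_le c x := (core.norm_smul c x).le

theorem eventually_norm_lt {x : BoundedFamily U M} {r : ℝ} (h : ‖x‖ < r) :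
    ∀ᶠ k in U, ‖x.val k‖ < r := x.tendsto_norm.eventually_lt_const h

theorem norm_le_of_eventually {x : BoundedFamily U M} {r : ℝ}
    (h : ∀ᶠ k in U, ‖x.val k‖ ≤ r) : ‖x‖ ≤ r := le_of_tendsto x.tendsto_norm h

theorem norm_sub_le_of_eventually {x y : BoundedFamily U M} {r : ℝ}
    (h : ∀ᶠ k in U, ‖x.val k - y.val k‖ ≤ r) : ‖x - y‖ ≤ r := norm_le_of_eventually h

theorem eventually_norm_sub_lt {x y : BoundedFamily U M} {r : ℝ} (h : ‖x - y‖ < r) :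
    ∀ᶠ k in U, ‖x.val k - y.val k‖ < r := eventually_norm_lt h

/-- Bounded witnesses in almost all factors form a bounded family. -/
theorem exists_boundedFamily {P : ∀ k, (M k).carrier → Prop} {r : ℝ}
    (h : ∀ᶠ k in U, ∃ y, ‖y‖ ≤ r ∧ P k y) :
    ∃ y : BoundedFamily U M, ‖y‖ ≤ r ∧ ∀ᶠ k in U, P k (y.val k) := by
  obtain ⟨y, hy⟩ := Filter.skolem.1 h
  exact ⟨⟨y, r, hy.mono fun k hk => hk.1⟩, norm_le_of_eventually (hy.mono fun k hk => hk.1),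
    hy.mono fun k hk => hk.2⟩

/-- Finitely many bounded families have a common integral bound. -/
theorem exists_nat_bound {m : ℕ} (x : Fin m → BoundedFamily U M) :
    ∃ N : ℕ, ∀ j, ‖x j‖ < N := by
  obtain ⟨C, hC⟩ := (Set.finite_range fun j => ‖x j‖).bddAbove
  obtain ⟨N, hN⟩ := exists_nat_gt C
  exact ⟨N, fun j => (hC ⟨j, rfl⟩).trans_lt hN⟩

theorem eventually_forall_norm_lt {m : ℕ} {x : Fin m → BoundedFamily U M} {r : ℝ}
    (h : ∀ j, ‖x j‖ < r) : ∀ᶠ k in U, ∀ j, ‖(x j).val k‖ < r :=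
  eventually_all.2 fun j => eventually_norm_lt (h j)

/-- The function symbol `f` applied memberwise. -/
def funMap {m : ℕ} (f : Ω.Func m) (x : Fin m → BoundedFamily U M) : BoundedFamily U M :=
  ⟨fun k => (M k).funMap f fun j => (x j).val k, by
    obtain ⟨N, hN⟩ := exists_nat_bound x
    refine ⟨Ω.funBound f N, ?_⟩
    filter_upwards [eventually_forall_norm_lt hN] with k hk
    exact (M k).fun_bound f N _ fun j => (hk j).le⟩

theorem val_funMap {m : ℕ} (f : Ω.Func m) (x : Fin m → BoundedFamily U M) (k : ℕ) :
    (funMap f x).val k = (M k).funMap f fun j => (x j).val k := rfl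

/-- The relation symbol `R` applied memberwise, followed by the limit along the ultrafilter. -/
noncomputable def relMap {m : ℕ} (R : Ω.Rel m) (x : Fin m → BoundedFamily U M) : ℝ :=
  ultralim U fun k => (M k).relMap R fun j => (x j).val k

theorem tendsto_relMap {m : ℕ} (R : Ω.Rel m) (x : Fin m → BoundedFamily U M) :
    Tendsto (fun k => (M k).relMap R fun j => (x j).val k) U (𝓝 (relMap R x)) := by
  obtain ⟨N, hN⟩ := exists_nat_bound x
  refine tendsto_ultralim (C := Ω.relBound R N) ?_
  filter_upwards [eventually_forall_norm_lt hN] with k hk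
  exact (M k).rel_bound R N _ fun j => (hk j).le

theorem funMap_unif {m : ℕ} (f : Ω.Func m) (N : ℕ+) (ε : {ε : ℚ // 0 < ε})
    {x y : Fin m → BoundedFamily U M} (h : ∀ j, ‖x j‖ < (N : ℕ) ∧ ‖y j‖ < (N : ℕ) ∧
      ‖x j - y j‖ < ((Ω.funMod f N ε : ℚ) : ℝ)) :
    ‖funMap f x - funMap f y‖ ≤ ((ε : ℚ) : ℝ) := by
  refine norm_sub_le_of_eventually ?_
  filter_upwards [eventually_forall_norm_lt fun j => (h j).1,
    eventually_forall_norm_lt fun j => (h j).2.1,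
    eventually_all.2 fun j => eventually_norm_sub_lt (h j).2.2] with k h1 h2 h3
  exact (M k).fun_unif f N ε _ _ fun j => ⟨h1 j, h2 j, h3 j⟩

theorem relMap_unif {m : ℕ} (R : Ω.Rel m) (N : ℕ+) (ε : {ε : ℚ // 0 < ε})
    {x y : Fin m → BoundedFamily U M} (h : ∀ j, ‖x j‖ < (N : ℕ) ∧ ‖y j‖ < (N : ℕ) ∧
      ‖x j - y j‖ < ((Ω.relMod R N ε : ℚ) : ℝ)) :
    |relMap R x - relMap R y| ≤ ((ε : ℚ) : ℝ) := by
  refine le_of_tendsto ((tendsto_relMap R x).sub (tendsto_relMap R y)).abs ?_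
  filter_upwards [eventually_forall_norm_lt fun j => (h j).1,
    eventually_forall_norm_lt fun j => (h j).2.1,
    eventually_all.2 fun j => eventually_norm_sub_lt (h j).2.2] with k h1 h2 h3
  exact (M k).rel_unif R N ε _ _ fun j => ⟨h1 j, h2 j, h3 j⟩

theorem le_of_forall_rat {t l : ℝ} (h : ∀ ε : {ε : ℚ // 0 < ε}, t ≤ l + ((ε : ℚ) : ℝ)) : t ≤ l := by
  refine le_of_forall_pos_le_add fun ε hε => ?_
  obtain ⟨q, hq, hqε⟩ := exists_rat_btwn hε
  linarith [h ⟨q, by exact_mod_cast hq⟩]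

theorem exists_pnat_bound {m : ℕ} (x y : Fin m → BoundedFamily U M) :
    ∃ N : ℕ+, ∀ j, ‖x j‖ < (N : ℕ) ∧ ‖y j‖ < (N : ℕ) := by
  obtain ⟨N, hN⟩ := exists_nat_bound x
  obtain ⟨N', hN'⟩ := exists_nat_bound y
  refine ⟨⟨N + N' + 1, by lia⟩, fun j => ?_⟩
  have h1 := hN j
  have h2 := hN' j
  have h3 : (0 : ℝ) ≤ N := by positivity
  have h4 : (0 : ℝ) ≤ N' := by positivity
  simp only [PNat.mk_coe]
  push_cast
  constructor <;> linarith

theorem funMap_congr {m : ℕ} (f : Ω.Func m) {x y : Fin m → BoundedFamily U M}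
    (h : ∀ j, ‖x j - y j‖ = 0) : ‖funMap f x - funMap f y‖ = 0 := by
  obtain ⟨N, hN⟩ := exists_pnat_bound x y
  refine le_antisymm (le_of_forall_rat fun ε => ?_) (norm_nonneg _)
  rw [zero_add]
  refine funMap_unif f N ε fun j => ⟨(hN j).1, (hN j).2, ?_⟩
  rw [h j]
  exact_mod_cast (Ω.funMod f N ε).2

theorem relMap_congr {m : ℕ} (R : Ω.Rel m) {x y : Fin m → BoundedFamily U M}
    (h : ∀ j, ‖x j - y j‖ = 0) : relMap R x = relMap R y := by
  obtain ⟨N, hN⟩ := exists_pnat_bound x y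
  rw [← sub_eq_zero, ← abs_eq_zero]
  refine le_antisymm (le_of_forall_rat fun ε => ?_) (abs_nonneg _)
  rw [zero_add]
  refine relMap_unif R N ε fun j => ⟨(hN j).1, (hN j).2, ?_⟩
  rw [h j]
  exact_mod_cast (Ω.relMod R N ε).2

/-- A family whose limiting norm is at most `r` is equivalent to one whose members all have norm
at most `r`: project each member radially to the ball. -/
theorem exists_norm_val_le (x : BoundedFamily U M) {r : ℝ} (hr : 0 ≤ r) (hx : ‖x‖ ≤ r) :
    ∃ y : BoundedFamily U M, (∀ k, ‖y.val k‖ ≤ r) ∧ ‖x - y‖ = 0 := by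
  classical
  let y : ∀ k, (M k).carrier :=
    fun k => if ‖x.val k‖ ≤ r then x.val k else (r / ‖x.val k‖) • x.val k
  have hy : ∀ k, ‖y k‖ ≤ r ∧ ‖x.val k - y k‖ ≤ max (‖x.val k‖ - r) 0 := by
    intro k
    by_cases hk : ‖x.val k‖ ≤ r
    · simp only [y, if_pos hk]
      exact ⟨hk, by simp⟩
    · have hpos : 0 < ‖x.val k‖ := hr.trans_lt (not_le.1 hk)
      have hdiff : x.val k - (r / ‖x.val k‖) • x.val k = (1 - r / ‖x.val k‖) • x.val k := by
        rw [sub_smul, one_smul]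
      have hle : r / ‖x.val k‖ ≤ 1 := (div_le_one hpos).2 (not_le.1 hk).le
      simp only [y, if_neg hk]
      rw [hdiff, norm_smul, norm_smul, Real.norm_of_nonneg (by positivity),
        Real.norm_of_nonneg (by linarith), div_mul_cancel₀ _ hpos.ne', sub_mul, one_mul,
        div_mul_cancel₀ _ hpos.ne']
      exact ⟨le_rfl, le_max_left _ _⟩
  refine ⟨⟨y, r, Eventually.of_forall fun k => (hy k).1⟩, fun k => (hy k).1,
    le_antisymm ?_ (norm_nonneg _)⟩
  have hlim : Tendsto (fun k => max (‖x.val k‖ - r) 0) U (𝓝 (max (‖x‖ - r) 0)) :=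
    (x.tendsto_norm.sub_const r).max tendsto_const_nhds
  rw [max_eq_right (by linarith)] at hlim
  exact le_of_tendsto_of_tendsto' (tendsto_norm _) hlim fun k => (hy k).2

end BoundedFamily

open BoundedFamily

theorem mk_eq_mk_iff_norm_sub {E : Type*} [SeminormedAddCommGroup E] {x y : E} :
    SeparationQuotient.mk x = SeparationQuotient.mk y ↔ ‖x - y‖ = 0 := by
  rw [SeparationQuotient.mk_eq_mk, Metric.inseparable_iff, dist_eq_norm]

/-- A bounded family representing a given element of the ultraproduct. -/
noncomputable def representative (x : SeparationQuotient (BoundedFamily U M)) :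
    BoundedFamily U M :=
  (SeparationQuotient.surjective_mk x).choose

variable {U M} in
theorem mk_representative (x : SeparationQuotient (BoundedFamily U M)) :
    SeparationQuotient.mk (representative U M x) = x :=
  (SeparationQuotient.surjective_mk x).choose_spec

variable {U M} in
theorem norm_representative (x : SeparationQuotient (BoundedFamily U M)) :
    ‖representative U M x‖ = ‖x‖ := by
  conv_rhs => rw [← mk_representative x, SeparationQuotient.norm_mk]

variable {U M} in
theorem norm_representative_sub (x y : SeparationQuotient (BoundedFamily U M)) :
    ‖representative U M x - representative U M y‖ = ‖x - y‖ := by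
  conv_rhs => rw [← mk_representative x, ← mk_representative y, ← SeparationQuotient.mk_sub,
    SeparationQuotient.norm_mk]

variable {U M} in
theorem norm_sub_representative_mk (x : BoundedFamily U M) :
    ‖x - representative U M (SeparationQuotient.mk x)‖ = 0 :=
  mk_eq_mk_iff_norm_sub.1 (mk_representative _).symm

/-- The ultraproduct of the structures `M k`: bounded families modulo the families whose norms tend
to `0` along the ultrafilter. -/
noncomputable def ultraproduct : NormedStructure.{u, w} Ω where
  carrier := SeparationQuotient (BoundedFamily U M)
  funMap f x := SeparationQuotient.mk (funMap f fun j => representative U M (x j))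
  relMap R x := relMap R fun j => representative U M (x j)
  fun_unif f N ε x y h := by
    rw [← SeparationQuotient.mk_sub, SeparationQuotient.norm_mk]
    refine funMap_unif f N ε fun j => ?_
    rw [norm_representative, norm_representative, norm_representative_sub]
    exact h j
  rel_unif R N ε x y h := by
    refine relMap_unif R N ε fun j => ?_
    rw [norm_representative, norm_representative, norm_representative_sub]
    exact h j
  fun_bound f N x h := by
    choose y hy hxy using fun j => exists_norm_val_le (representative U M (x j)) N.cast_nonneg
      ((norm_representative (x j)).trans_le (h j))
    rw [mk_eq_mk_iff_norm_sub.2 (funMap_congr f hxy), SeparationQuotient.norm_mk]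
    exact norm_le_of_eventually
      (Eventually.of_forall fun k => (M k).fun_bound f N _ fun j => hy j k)
  rel_bound R N x h := by
    choose y hy hxy using fun j => exists_norm_val_le (representative U M (x j)) N.cast_nonneg
      ((norm_representative (x j)).trans_le (h j))
    rw [relMap_congr R hxy]
    exact le_of_tendsto' (tendsto_relMap R y).abs fun k => (M k).rel_bound R N _ fun j => hy j k

/-! ### Łoś's theorem for approximations, and saturation of ultraproducts -/

/-- The element of the ultraproduct represented by a bounded family. -/
noncomputable def quotMk (x : BoundedFamily U M) : (ultraproduct U M).carrier :=
  (SeparationQuotient.mk x : SeparationQuotient (BoundedFamily U M))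

/-- The assignment in the ultraproduct given by an assignment of bounded families. -/
noncomputable def quotAssignment (b : ℕ → BoundedFamily U M) (x : ℕ) : (ultraproduct U M).carrier :=
  quotMk U M (b x)

variable {U M}

theorem quotMk_surjective : Function.Surjective (quotMk U M) :=
  SeparationQuotient.surjective_mk

theorem quotAssignment_surjective (a : ℕ → (ultraproduct U M).carrier) :
    ∃ b, quotAssignment U M b = a :=
  ⟨fun x => representative U M (a x), funext fun x => mk_representative (a x)⟩

theorem update_quotAssignment (b : ℕ → BoundedFamily U M) (x : ℕ) (y : BoundedFamily U M) :
    Function.update (quotAssignment U M b) x (quotMk U M y) =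
      quotAssignment U M (Function.update b x y) := by
  funext z
  by_cases hz : z = x
  · subst hz
    rw [Function.update_self, quotAssignment, Function.update_self]
  · rw [Function.update_of_ne hz, quotAssignment, quotAssignment, Function.update_of_ne hz]

theorem val_update (b : ℕ → BoundedFamily U M) (x : ℕ) (y : BoundedFamily U M) (k : ℕ) :
    (fun z => (Function.update b x y z).val k) =
      Function.update (fun z => (b z).val k) x (y.val k) := by
  funext z
  by_cases hz : z = x
  · subst hz; simp
  · simp [hz]

theorem norm_quotAssignment_sub (b c : ℕ → BoundedFamily U M) (x : ℕ) :
    ‖quotAssignment U M b x - quotAssignment U M c x‖ = ‖b x - c x‖ := rfl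

/-- Terms are evaluated memberwise. -/
theorem Term.eval_ultraproduct (b : ℕ → BoundedFamily U M) (t : Term Ω) :
    ∃ s : BoundedFamily U M, (∀ k, s.val k = t.eval (M k) fun x => (b x).val k) ∧
      t.eval (ultraproduct U M) (quotAssignment U M b) =
        quotMk U M s := by
  induction t with
  | var x => exact ⟨b x, fun k => rfl, rfl⟩
  | zero => exact ⟨0, fun k => rfl, rfl⟩
  | add s t hs ht =>
    obtain ⟨s', hs, hs'⟩ := hs
    obtain ⟨t', ht, ht'⟩ := ht
    refine ⟨s' + t', fun k => ?_, ?_⟩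
    · rw [val_add, hs, ht, Term.eval]
    · rw [Term.eval, hs', ht']
      rfl
  | smul q t ht =>
    obtain ⟨t', ht, ht'⟩ := ht
    refine ⟨(q : ℝ) • t', fun k => ?_, ?_⟩
    · rw [val_smul, ht, Term.eval]
    · rw [Term.eval, ht']
      rfl
  | func f ts ih =>
    choose s hs hs' using ih
    refine ⟨funMap f s, fun k => ?_, ?_⟩
    · rw [val_funMap, Term.eval]
      simp only [hs]
    · rw [Term.eval, funext hs']
      exact (mk_eq_mk_iff_norm_sub.2
        (funMap_congr f fun j => norm_sub_representative_mk (s j))).symm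

theorem Term.tendsto_norm_eval (b : ℕ → BoundedFamily U M) (t : Term Ω) :
    Tendsto (fun k => ‖t.eval (M k) fun x => (b x).val k‖) U
      (𝓝 ‖t.eval (ultraproduct U M) (quotAssignment U M b)‖) := by
  obtain ⟨s, hs, hs'⟩ := t.eval_ultraproduct b
  simp only [← hs, hs']
  exact s.tendsto_norm

theorem Term.tendsto_relMap_eval {m : ℕ} (R : Ω.Rel m) (b : ℕ → BoundedFamily U M)
    (ts : Fin m → Term Ω) :
    Tendsto (fun k => (M k).relMap R fun j => (ts j).eval (M k) fun x => (b x).val k) U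
      (𝓝 ((ultraproduct U M).relMap R
        fun j => (ts j).eval (ultraproduct U M) (quotAssignment U M b))) := by
  choose s hs hs' using fun j => (ts j).eval_ultraproduct b
  simp only [← hs, funext hs']
  have h : relMap R s = (ultraproduct U M).relMap R
      fun j => quotMk U M (s j) :=
    relMap_congr R fun j => norm_sub_representative_mk (s j)
  rw [← h]
  exact tendsto_relMap R s

/-- Łoś's theorem for approximations.  An approximation passes from the ultraproduct to almost all
of its factors and back, at the cost of some tolerance. -/
theorem PBFormula.los {n m : ℕ} (hnm : n < m) (φ : PBFormula Ω) (b : ℕ → BoundedFamily U M) :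
    ((φ.approx m).Sat (ultraproduct U M) (quotAssignment U M b) →
      ∀ᶠ k in U, (φ.approx n).Sat (M k) fun x => (b x).val k) ∧
    ((∀ᶠ k in U, (φ.approx m).Sat (M k) fun x => (b x).val k) →
      (φ.approx n).Sat (ultraproduct U M) (quotAssignment U M b)) := by
  have hlt := one_div_succ_strictAnti hnm
  induction φ generalizing b with
  | normLe t r =>
    constructor <;> intro h <;> simp only [PBFormula.approx, PBFormula.Sat] at h ⊢ <;>
      push_cast at h ⊢
    · exact ((t.tendsto_norm_eval b).eventually_lt_const (h.trans_lt (by linarith))).mono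
        fun _ hk => hk.le
    · linarith [le_of_tendsto (t.tendsto_norm_eval b) h]
  | normGe t r =>
    constructor <;> intro h <;> simp only [PBFormula.approx, PBFormula.Sat] at h ⊢ <;>
      push_cast at h ⊢
    · exact ((t.tendsto_norm_eval b).eventually_const_lt (lt_of_lt_of_le (by linarith) h)).mono
        fun _ hk => hk.le
    · linarith [ge_of_tendsto (t.tendsto_norm_eval b) h]
  | relLe R ts r =>
    constructor <;> intro h <;> simp only [PBFormula.approx, PBFormula.Sat] at h ⊢ <;>
      push_cast at h ⊢
    · exact ((Term.tendsto_relMap_eval R b ts).eventually_lt_const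
        (h.trans_lt (by linarith))).mono fun _ hk => hk.le
    · linarith [le_of_tendsto (Term.tendsto_relMap_eval R b ts) h]
  | relGe R ts r =>
    constructor <;> intro h <;> simp only [PBFormula.approx, PBFormula.Sat] at h ⊢ <;>
      push_cast at h ⊢
    · exact ((Term.tendsto_relMap_eval R b ts).eventually_const_lt
        (lt_of_lt_of_le (by linarith) h)).mono fun _ hk => hk.le
    · linarith [ge_of_tendsto (Term.tendsto_relMap_eval R b ts) h]
  | and φ ψ hφ hψ =>
    refine ⟨fun h => ?_, fun h => ?_⟩
    · exact ((hφ b).1 h.1).and ((hψ b).1 h.2)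
    · exact ⟨(hφ b).2 (h.mono fun _ hk => hk.1), (hψ b).2 (h.mono fun _ hk => hk.2)⟩
  | or φ ψ hφ hψ =>
    refine ⟨fun h => ?_, fun h => ?_⟩
    · exact Ultrafilter.eventually_or.2 (h.imp (hφ b).1 (hψ b).1)
    · exact (Ultrafilter.eventually_or.1 h).imp (hφ b).2 (hψ b).2
  | inf φ ih =>
    simp only [PBFormula.approx, PBFormula.sat_bigAnd]
    refine ⟨fun h => ?_, fun h i hi => ?_⟩
    · exact (eventually_all_finite (Set.finite_Iic n)).2 fun i hi =>
        (ih i b).1 (h i (le_trans hi hnm.le))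
    · exact (ih i b).2 (h.mono fun _ hk => hk i (hi.trans hnm.le))
  | ex x r φ ih =>
    refine ⟨?_, fun h => ?_⟩
    · rintro ⟨y, hy, h⟩
      obtain ⟨y, rfl⟩ := quotMk_surjective y
      rw [update_quotAssignment] at h
      have hy' : ∀ᶠ k in U, ‖y.val k‖ < ((r + 1 / ((n : ℚ) + 1) : ℚ) : ℝ) :=
        eventually_norm_lt (lt_of_le_of_lt hy (by push_cast; linarith))
      filter_upwards [(ih _).1 h, hy'] with k hk hyk
      rw [val_update] at hk
      exact ⟨_, hyk.le, hk⟩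
    · obtain ⟨y, hy, hsat⟩ := exists_boundedFamily h
      refine ⟨quotMk U M y, ?_, ?_⟩
      · refine le_trans hy ?_
        push_cast
        linarith
      · rw [update_quotAssignment]
        refine (ih _).2 (hsat.mono fun k hk => ?_)
        rw [val_update]
        exact hk
  | all x r φ ih =>
    refine ⟨fun h => ?_, fun h y hy => ?_⟩
    · by_contra hcon
      rw [← Ultrafilter.eventually_not] at hcon
      simp only [PBFormula.approx, PBFormula.Sat, not_forall, exists_prop] at hcon
      obtain ⟨y, hy, hnot⟩ := exists_boundedFamily hcon
      have hsat := h (quotMk U M y) (le_trans hy (by push_cast; linarith))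
      rw [update_quotAssignment] at hsat
      obtain ⟨k, hk, hk'⟩ := (((ih _).1 hsat).and hnot).exists
      rw [val_update] at hk
      exact hk' hk
    · obtain ⟨y, rfl⟩ := quotMk_surjective y
      rw [update_quotAssignment]
      have hy' : ∀ᶠ k in U, ‖y.val k‖ < ((r - 1 / ((m : ℚ) + 1) : ℚ) : ℝ) :=
        eventually_norm_lt (lt_of_le_of_lt hy (by push_cast; linarith))
      refine (ih _).2 ?_
      filter_upwards [h, hy'] with k hk hyk
      rw [val_update]
      exact hk _ hyk.le

open Classical in
/-- Ultraproducts along nonprincipal ultrafilters are saturated.  At the index `k` the diagonal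
assignment uses the best approximate solution that is still good there. -/
theorem saturated_ultraproduct (hU : (U : Filter ℕ) ≤ atTop) : (ultraproduct U M).Saturated := by
  intro χ c r h
  obtain ⟨c, rfl⟩ := quotAssignment_surjective c
  choose b hb hsat using h
  choose b' hb' using fun n => quotAssignment_surjective (b n)
  obtain rfl : (fun n => quotAssignment U M (b' n)) = b := funext hb'
  let Good (n k : ℕ) : Prop :=
    (∀ x ≤ n, ‖(b' (n + 1) x).val k - (c x).val k‖ ≤ r x + 1 / ((n : ℝ) + 1)) ∧
      (χ.approx n).Sat (M k) fun x => (b' (n + 1) x).val k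
  have hGood : ∀ n, ∀ᶠ k in U, Good n k := by
    intro n
    refine ((eventually_all_finite (Set.finite_Iic n)).2 fun x _ => ?_).and
      ((χ.los n.lt_succ_self _).1 (hsat (n + 1)))
    have hlt := one_div_succ_strictAnti n.lt_succ_self
    exact (BoundedFamily.eventually_norm_sub_lt
      ((hb (n + 1) x).trans_lt (by linarith))).mono fun _ hk => hk.le
  let N (k : ℕ) : ℕ := Nat.findGreatest (fun n => Good n k) k
  have hN : ∀ n, ∀ᶠ k in U, n ≤ N k ∧ Good (N k) k := by
    intro n
    filter_upwards [hGood n, hU (eventually_ge_atTop n)] with k hk hnk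
    exact ⟨Nat.le_findGreatest hnk hk, Nat.findGreatest_spec (P := fun n => Good n k) hnk hk⟩
  have hclose : ∀ n x, x ≤ n → ∀ᶠ k in U,
      ‖(b' (N k + 1) x).val k - (c x).val k‖ ≤ r x + 1 / ((n : ℝ) + 1) := by
    intro n x hx
    filter_upwards [hN n] with k hk
    linarith [hk.2.1 x (hx.trans hk.1), one_div_succ_anti hk.1]
  let d (x : ℕ) : BoundedFamily U M := ⟨fun k => (b' (N k + 1) x).val k, by
    obtain ⟨C, hC⟩ := (c x).exists_bound
    refine ⟨r x + 1 / ((x : ℝ) + 1) + C, ?_⟩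
    filter_upwards [hC, hclose x x le_rfl] with k hk hk'
    calc ‖(b' (N k + 1) x).val k‖
        = ‖((b' (N k + 1) x).val k - (c x).val k) + (c x).val k‖ := by rw [sub_add_cancel]
      _ ≤ _ := (norm_add_le _ _).trans (add_le_add hk' hk)⟩
  refine ⟨quotAssignment U M d, fun x => ?_, fun n => (χ.los n.lt_succ_self d).2 ?_⟩
  · refine le_of_forall_le_add_one_div fun n => ?_
    rw [norm_quotAssignment_sub]
    refine (norm_sub_le_of_eventually (x := d x) (hclose (max n x) x (le_max_right _ _))).trans ?_
    linarith [one_div_succ_anti (le_max_left n x)]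
  · filter_upwards [hN (n + 1)] with k hk
    exact hk.2.2.approx_anti hk.1

/-! ### Model existence -/

/-- An approximately finitely consistent set of sentences has, along the chosen branches, a sequence
of structures each approximation of which holds in all but finitely many members. -/
theorem ApproxFinConsistent.exists_sequence (hΩ : Ω.IsCountable) {Θ : Set (LAFormula Ω)}
    (hΘ : ApproxFinConsistent.{u, w} Θ) :
    ∃ (h : ∀ σ : Θ, (σ : LAFormula Ω).Branch) (M : ℕ → NormedStructure.{u, w} Ω),
      ∀ (σ : Θ) n, ∀ᶠ k in atTop, ∀ a, (((σ : LAFormula Ω).along (h σ)).approx n).Sat (M k) a := by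
  classical
  obtain ⟨h, hh⟩ := hΘ
  let F (p : Θ × ℕ) : PBFormula Ω := ((p.1 : LAFormula Ω).along (h p.1)).approx p.2
  -- Although `Θ` may be uncountable, the set of approximations is countable.
  have hcount : (Set.range F).Countable :=
    (PBFormula.countable_range_ofTree hΩ).mono (by
      rintro _ ⟨p, rfl⟩
      exact PBFormula.approx_mem_range_ofTree _ _)
  have : Nonempty (PBFormula Ω) := ⟨.normLe .zero 0⟩
  obtain ⟨g, hg⟩ := Set.countable_iff_exists_subset_range.1 hcount
  have hM : ∀ k, ∃ E : NormedStructure.{u, w} Ω,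
      ∀ i ≤ k, g i ∈ Set.range F → ∀ a, (g i).Sat E a := by
    intro k
    have hp : ∀ i, ∃ P : Finset (Θ × ℕ), g i ∈ Set.range F → ∃ p ∈ P, F p = g i := fun i => by
      by_cases hi : g i ∈ Set.range F
      · obtain ⟨p, hp⟩ := hi
        exact ⟨{p}, fun _ => ⟨p, by simp, hp⟩⟩
      · exact ⟨∅, fun h => absurd h hi⟩
    choose P hP using hp
    let Q := (Finset.range (k + 1)).biUnion P
    obtain ⟨E, hE⟩ := hh (Q.image Prod.fst) (Q.sup Prod.snd)
    refine ⟨E, fun i hi hgi a => ?_⟩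
    obtain ⟨p, hp, hpi⟩ := hP i hgi
    have hpQ : p ∈ Q := Finset.mem_biUnion.2 ⟨i, Finset.mem_range.2 (Nat.lt_succ_of_le hi), hp⟩
    rw [← hpi]
    exact (hE p.1 (Finset.mem_image_of_mem _ hpQ) a).approx_anti
      (Finset.le_sup (f := Prod.snd) hpQ)
  choose M hM using hM
  refine ⟨h, M, fun σ n => ?_⟩
  obtain ⟨i, hi⟩ := hg ⟨(σ, n), rfl⟩
  filter_upwards [eventually_ge_atTop i] with k hk a
  have := hM k i hk (hi ▸ ⟨(σ, n), rfl⟩) a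
  rwa [hi] at this

end ApproxTruth

theorem mainTheorem2 (Ω : ApproxTruth.Signature.{u}) (hΩ : Ω.IsCountable)
    (Θ : Set (ApproxTruth.LAFormula Ω)) (hΘ : ∀ σ ∈ Θ, σ.IsSentence)
    (hcons : ApproxTruth.ApproxFinConsistent.{u, w} Θ) :
    ∃ E : ApproxTruth.NormedStructure.{u, w} Ω, ∀ σ ∈ Θ, ∀ a : ℕ → E.carrier,
      σ.ApproxSat E a ∧ σ.Sat E a := by
  obtain ⟨h, M, hM⟩ := hcons.exists_sequence hΩ
  let U := Filter.hyperfilter ℕ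
  have hU : (U : Filter ℕ) ≤ Filter.atTop := Nat.hyperfilter_le_atTop
  refine ⟨ApproxTruth.ultraproduct U M, fun σ hσ a => ?_⟩
  have hap : σ.ApproxSat (ApproxTruth.ultraproduct U M) a := by
    obtain ⟨b, rfl⟩ := ApproxTruth.quotAssignment_surjective a
    refine ⟨h ⟨σ, hσ⟩, fun n => (ApproxTruth.PBFormula.los n.lt_succ_self _ b).2 ?_⟩
    exact hU ((hM ⟨σ, hσ⟩ (n + 1)).mono fun k hk => hk _)
  exact ⟨hap, (ApproxTruth.LAFormula.approxSat_iff_sat hΩ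
    (ApproxTruth.saturated_ultraproduct hU) (hΘ σ hσ).1).1 hap⟩
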